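/- Let $d\ge 1$ be an integer and let $G=(V,E)$ be a finite simple graph. An e-labeling of $G$ is a function $f_E:E\to\mathbb{Z}_d$; a valid v-labeling of $(G,f_E)$ is a function $f_V:V\to\mathbb{Z}_d$ such that $f_E(\{u,v\})=f_V(u)+f_V(v)$ in $\mathbb{Z}_d$ for every edge $\{u,v\}\in E$; and $(G,f_E)$ is additive if it has a valid v-labeling. Let $\nu(G,f_E)$ be the number of valid v-labelings. The size of $(G,f_E)$ is $|V|+|E|+\ell(d)$, where $\ell(d)$ is the number of binary digits of $d$. Algorithms are programs for a random access machine (addition, truncated subtraction and halving of natural numbers, indirect addressing, reading the input and writing the output), and time is logarithmic cost: each instruction and each test costs one unit plus the binary lengths of all the register numbers and operands involved. The input consists of $|V|$, $|E|$, $d$ and a list, in any order, of the edges with their labels; the vertices are numbered $0,\dots,|V|-1$ and labels are given as integers in $\{0,\dots,d-1\}$. **Theorem.** 1. There are a program and a polynomial $p$ such that, for every $d\ge 1$ and every connected e-labeled graph $(G,f_E)$ with labels in $\mathbb{Z}_d$, the program decides whether $(G,f_E)$ is additive in time at most $p(|V|+|E|+\ell(d))$. 2. There are a program and a polynomial $q$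 such that, for every $d\ge 1$ and every connected e-labeled graph $(G,f_E)$ with labels in $\mathbb{Z}_d$, the program outputs all the valid v-labelings of $(G,f_E)$, each exactly once, in time at most $q(|V|+|E|+\ell(d)+\nu(G,f_E))$. -/

import Mathlib

/-! ## Edge labelings of graphs -/

/-- `fV` is a valid v-labeling of the e-labeled graph `(G, fE)`: the label of every edge is the
sum, modulo `d`, of the labels of its two ends. -/
def IsValidVLabeling {V : Type*} {d : ℕ} (G : SimpleGraph V) (fE : G.edgeSet → ZMod d)
    (fV : V → ZMod d) : Prop :=
  ∀ (u v : V) (h : G.Adj u v), fE ⟨s(u, v), h⟩ = fV u + fV v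

/-- `(G, fE)` is additive: it has a valid v-labeling. -/
def IsAdditive {V : Type*} {d : ℕ} (G : SimpleGraph V) (fE : G.edgeSet → ZMod d) : Prop :=
  ∃ fV : V → ZMod d, IsValidVLabeling G fE fV

/-- The number of valid v-labelings of `(G, fE)`. -/
noncomputable def numValid {V : Type*} {d : ℕ} (G : SimpleGraph V) (fE : G.edgeSet → ZMod d) : ℕ :=
  Nat.card {fV : V → ZMod d // IsValidVLabeling G fE fV}

/-! ## Random access machines with logarithmic cost -/

namespace RAM

/-- A machine has registers `mem 0, mem 1, …` holding natural numbers of any size, an input tape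
that is read once from left to right, and an output tape. -/
structure State where
  mem : ℕ → ℕ
  inp : List ℕ
  out : List ℕ

/-- Elementary instructions; `i`, `j`, `k` are numbers of registers. -/
inductive Instr where
  /-- `mem i := c` -/
  | const (i c : ℕ)
  /-- `mem i := mem j + mem k` -/
  | add (i j k : ℕ)
  /-- `mem i := max (mem j - mem k) 0` -/
  | sub (i j k : ℕ)
  /-- `mem i := ⌊mem j / 2⌋` -/
  | half (i j : ℕ)
  /-- `mem i := mem (mem j)` -/
  | load (i j : ℕ)
  /-- `mem (mem i) := mem j` -/
  | store (i j : ℕ)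
  /-- move the next number of the input tape (`0` if there is none) to `mem i` -/
  | read (i : ℕ)
  /-- append `mem i` to the output tape -/
  | write (i : ℕ)

/-- The effect of an instruction. -/
def Instr.apply : Instr → State → State
  | .const i c, s => { s with mem := Function.update s.mem i c }
  | .add i j k, s => { s with mem := Function.update s.mem i (s.mem j + s.mem k) }
  | .sub i j k, s => { s with mem := Function.update s.mem i (s.mem j - s.mem k) }
  | .half i j, s => { s with mem := Function.update s.mem i (s.mem j / 2) }
  | .load i j, s => { s with mem := Function.update s.mem i (s.mem (s.mem j)) }
  | .store i j, s => { s with mem := Function.update s.mem (s.mem i) (s.mem j) }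
  | .read i, s => { s with mem := Function.update s.mem i (s.inp.headD 0), inp := s.inp.tail }
  | .write i, s => { s with out := s.out ++ [s.mem i] }

/-- One unit of time, plus the binary lengths of all the numbers in the list. -/
def bitCost (l : List ℕ) : ℕ := 1 + (l.map Nat.size).sum

/-- The logarithmic cost of an instruction: one unit, plus the binary lengths of all the
register numbers and of all the operands that are involved. -/
def Instr.cost : Instr → State → ℕ
  | .const i c, _ => bitCost [i, c]
  | .add i j k, s => bitCost [i, j, k, s.mem j, s.mem k]
  | .sub i j k, s => bitCost [i, j, k, s.mem j, s.mem k]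
  | .half i j, s => bitCost [i, j, s.mem j]
  | .load i j, s => bitCost [i, j, s.mem j, s.mem (s.mem j)]
  | .store i j, s => bitCost [i, j, s.mem i, s.mem j]
  | .read i, s => bitCost [i, s.inp.headD 0]
  | .write i, s => bitCost [i, s.mem i]

/-- Programs: finite objects, built from instructions with structured control flow. -/
inductive Program where
  | instr (a : Instr)
  | seq (P Q : Program)
  /-- if `mem i ≠ 0` then `P` else `Q` -/
  | ite (i : ℕ) (P Q : Program)
  /-- while `mem i ≠ 0` do `P` -/
  | loop (i : ℕ) (P : Program)

/-- `Exec P s s' t`: started in state `s`, the program `P` halts in state `s'` after time `t`.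
Every test of a register is charged for in the same way as an instruction. -/
inductive Exec : Program → State → State → ℕ → Prop where
  | instr (a : Instr) (s : State) : Exec (.instr a) s (a.apply s) (a.cost s)
  | seq {P Q : Program} {s s₁ s₂ : State} {t₁ t₂ : ℕ} :
      Exec P s s₁ t₁ → Exec Q s₁ s₂ t₂ → Exec (.seq P Q) s s₂ (t₁ + t₂)
  | ite_true {i : ℕ} {P Q : Program} {s s' : State} {t : ℕ} :
      s.mem i ≠ 0 → Exec P s s' t → Exec (.ite i P Q) s s' (bitCost [i, s.mem i] + t)
  | ite_false {i : ℕ} {P Q : Program} {s s' : State} {t : ℕ} :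
      s.mem i = 0 → Exec Q s s' t → Exec (.ite i P Q) s s' (bitCost [i, s.mem i] + t)
  | loop_true {i : ℕ} {P : Program} {s s₁ s₂ : State} {t₁ t₂ : ℕ} :
      s.mem i ≠ 0 → Exec P s s₁ t₁ → Exec (.loop i P) s₁ s₂ t₂ →
        Exec (.loop i P) s s₂ (bitCost [i, s.mem i] + t₁ + t₂)
  | loop_false {i : ℕ} {P : Program} {s : State} :
      s.mem i = 0 → Exec (.loop i P) s s (bitCost [i, s.mem i])

/-- On the input `x`, with all registers zero at the start, the program halts within time `T`
and its output is `y`. -/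
def Computes (P : Program) (x y : List ℕ) (T : ℕ) : Prop :=
  ∃ (s : State) (t : ℕ), Exec P ⟨fun _ => 0, x, []⟩ s t ∧ s.out = y ∧ t ≤ T

end RAM

/-! ## Labeled graphs as inputs, labelings as outputs -/

/-- The list `L` of triples (end, other end, label) contains every edge of `(G, fE)` exactly once,
in one of its two orientations and in any order. -/
def ListsEdges {n d : ℕ} (G : SimpleGraph (Fin n)) (fE : G.edgeSet → ZMod d)
    (L : List (Fin n × Fin n × ZMod d)) : Prop :=
  (L.map fun x => s(x.1, x.2.1)).Nodup ∧
    ∀ (u v : Fin n) (c : ZMod d),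
      ((u, v, c) ∈ L ∨ (v, u, c) ∈ L) ↔ ∃ h : G.Adj u v, fE ⟨s(u, v), h⟩ = c

/-- The input `n, m, d, u₁, v₁, c₁, …, uₘ, vₘ, cₘ`: the number of vertices `0, …, n - 1`, the
number of edges, the modulus, and the edges `uⱼ vⱼ` with labels `cⱼ ∈ {0, …, d - 1}`. -/
def inputOf {n d : ℕ} (L : List (Fin n × Fin n × ZMod d)) : List ℕ :=
  n :: L.length :: d :: L.flatMap fun x => [x.1.val, x.2.1.val, x.2.2.val]

/-- A list of v-labelings, written one after the other; each of them as the list of the labels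
(in `{0, …, d - 1}`) of the vertices `0, …, n - 1`. -/
def outputOf {n d : ℕ} (F : List (Fin n → ZMod d)) : List ℕ :=
  F.flatMap fun fV => List.ofFn fun i => (fV i).val

/-- The size of an e-labeled graph with labels modulo `d`: the number of vertices plus the number
of edges plus the binary length of `d`. -/
noncomputable def graphSize {n : ℕ} (G : SimpleGraph (Fin n)) (d : ℕ) : ℕ :=
  n + Nat.card G.edgeSet + Nat.size d

/-! In a connected graph a valid v-labeling is determined by its value `x` at vertex `0`: an edge
labeled `c` forces the value at one end to be `c` minus the value at the other. `check` propagates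
`x` in this way, by `n` passes over all directed edges. Every vertex is reached by a path with at
most `n - 1` edges, so `n - 1` passes label everything and the last pass tests every edge. A
labeling with value `x` at `0` exists iff no discrepancy was recorded (`check_iff`).

Trying all `d` values of `x` would be exponential in the length of `d`. Instead, propagate from `x =
0`. If a valid `f` has value `t` at vertex `0`, each propagated value differs from `f` by `t` or
`-t`, because crossing an edge flips the sign; a recorded discrepancy `e` is therefore `0` or `±2t`
(`near_check`). So either `0` works, or `2t = ±e`, which leaves four candidates for `t`
(`mem_candidates`, `isAdditive_iff`).

For the enumeration, take a value `y` that works and test `y + 1`. If it works too, two labelings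
differ by `1` at vertex `0`, and multiples of their difference realize every value
(`IsValidVLabeling.add_smul_sub`). Then there are at least `d` labelings (`card_of_two`), and a loop
over all residues is paid for by the output. If `y + 1` fails, no two labelings differ at `0` by
some `t` with `2t ≠ 0`, as this would again realize every value
(`IsValidVLabeling.exists_of_two_mul_ne_zero`); only `y` and `y + d / 2` remain
(`labelings_starts`).

On the machine it suffices to count steps. A step lengthens numbers by at most one bit, so `k` steps
cost at most `k * (1 + 5 * (W + k))` if `W` bounds the initial lengths and the width of the program
(`WP`). -/

/-! ## Unit-cost reasoning about programs -/

namespace RAM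

/-- The numbers that are written in an instruction. -/
def Instr.literals : Instr → List ℕ
  | .const i c => [i, c]
  | .add i j k => [i, j, k]
  | .sub i j k => [i, j, k]
  | .half i j => [i, j]
  | .load i j => [i, j]
  | .store i j => [i, j]
  | .read i => [i]
  | .write i => [i]

/-- The total binary length of the numbers that are written in a program. -/
def Program.width : Program → ℕ
  | .instr a => (a.literals.map Nat.size).sum
  | .seq P Q => P.width + Q.width
  | .ite i P Q => Nat.size i + P.width + Q.width
  | .loop i P => Nat.size i + P.width

/-- All numbers in the registers and on the input tape have binary length at most `W`. -/
def State.Fits (s : State) (W : ℕ) : Prop :=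
  (∀ r, Nat.size (s.mem r) ≤ W) ∧ ∀ x ∈ s.inp, Nat.size x ≤ W

theorem State.Fits.mono {s : State} {W W' : ℕ} (h : s.Fits W) (hW : W ≤ W') : s.Fits W' :=
  ⟨fun r => (h.1 r).trans hW, fun x hx => (h.2 x hx).trans hW⟩

theorem State.Fits.update {m : ℕ → ℕ} {inp out : List ℕ} {W x : ℕ} (h : State.Fits ⟨m, inp, out⟩ W)
    (i : ℕ) (hx : Nat.size x ≤ W) : State.Fits ⟨Function.update m i x, inp, out⟩ W := by
  refine ⟨fun r => ?_, h.2⟩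
  by_cases hr : r = i
  · subst hr; simpa using hx
  · simpa [hr] using h.1 r

theorem size_add_le {a b W : ℕ} (ha : Nat.size a ≤ W) (hb : Nat.size b ≤ W) :
    Nat.size (a + b) ≤ W + 1 := by
  rw [Nat.size_le] at *
  rw [pow_succ]; omega

theorem Fits.headD {l : List ℕ} {W : ℕ} (h : ∀ x ∈ l, Nat.size x ≤ W) :
    Nat.size (l.headD 0) ≤ W := by
  cases l <;> simp_all

/-- Only an addition can produce a number longer than its operands, by one bit; a constant is
covered by the width of the instruction. -/
theorem Instr.fits_apply (a : Instr) {s : State} {W : ℕ} (ha : (Program.instr a).width ≤ W)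
    (h : s.Fits W) : (a.apply s).Fits (W + 1) := by
  obtain ⟨m, inp, out⟩ := s
  have h' := h.mono (Nat.le_succ W)
  cases a with
  | const i c =>
    refine h'.update i ?_
    simp [Program.width, Instr.literals] at ha; omega
  | add i j k => exact h'.update i (size_add_le (h.1 j) (h.1 k))
  | sub i j k => exact h'.update i ((Nat.size_le_size (Nat.sub_le _ _)).trans (h'.1 j))
  | half i j => exact h'.update i ((Nat.size_le_size (Nat.div_le_self _ _)).trans (h'.1 j))
  | load i j => exact h'.update i (h'.1 _)
  | store i j => exact h'.update _ (h'.1 j)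
  | read i =>
    have := h'.update i (Fits.headD h'.2)
    exact ⟨this.1, fun x hx => h'.2 x (List.mem_of_mem_tail hx)⟩
  | write i => exact h'

/-- At most five numbers are involved, in `add` and `sub`: three register numbers and two operands.
-/
theorem Instr.cost_le (a : Instr) {s : State} {W : ℕ} (ha : (Program.instr a).width ≤ W)
    (h : s.Fits W) : a.cost s ≤ 1 + 5 * W := by
  have h1 := h.1
  cases a with
  | const i c => simp [Program.width, Instr.literals, Instr.cost, bitCost] at *; omega
  | add i j k =>
    have := h1 j; have := h1 k
    simp [Program.width, Instr.literals, Instr.cost, bitCost] at *; omega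
  | sub i j k =>
    have := h1 j; have := h1 k
    simp [Program.width, Instr.literals, Instr.cost, bitCost] at *; omega
  | half i j =>
    have := h1 j
    simp [Program.width, Instr.literals, Instr.cost, bitCost] at *; omega
  | load i j =>
    have := h1 j; have := h1 (s.mem j)
    simp [Program.width, Instr.literals, Instr.cost, bitCost] at *; omega
  | store i j =>
    have := h1 i; have := h1 j
    simp [Program.width, Instr.literals, Instr.cost, bitCost] at *; omega
  | read i =>
    have := Fits.headD h.2
    simp [Program.width, Instr.literals, Instr.cost, bitCost] at *; omega
  | write i =>
    have := h1 i
    simp [Program.width, Instr.literals, Instr.cost, bitCost] at *; omega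

/-- Started in `s`, the program `P` halts in a state that satisfies `Q`, after at most `k` steps
(instructions and tests). Since a step lengthens the numbers by at most one bit, this bounds the
logarithmic cost, too. -/
def WP (P : Program) (s : State) (k : ℕ) (Q : State → Prop) : Prop :=
  ∃ s' t, Exec P s s' t ∧ Q s' ∧
    ∀ W, P.width ≤ W → s.Fits W → s'.Fits (W + k) ∧ t ≤ k * (1 + 5 * (W + k))

theorem WP.mono {P : Program} {s : State} {k k' : ℕ} {Q Q' : State → Prop} (h : WP P s k Q)
    (hk : k ≤ k') (hQ : ∀ s', Q s' → Q' s') : WP P s k' Q' := by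
  obtain ⟨s', t, he, hq, hW⟩ := h
  refine ⟨s', t, he, hQ _ hq, fun W h1 h2 => ?_⟩
  obtain ⟨h3, h4⟩ := hW W h1 h2
  exact ⟨h3.mono (by omega), h4.trans (by gcongr)⟩

theorem WP.instr {a : Instr} {s : State} {Q : State → Prop} (h : Q (a.apply s)) :
    WP (.instr a) s 1 Q :=
  ⟨_, _, Exec.instr a s, h, fun W h1 h2 => ⟨a.fits_apply h1 h2, by
    have := a.cost_le h1 h2
    omega⟩⟩

theorem WP.seq {P P' : Program} {s : State} {k k' : ℕ} {Q : State → Prop}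
    (h : WP P s k fun s₁ => WP P' s₁ k' Q) : WP (.seq P P') s (k + k') Q := by
  obtain ⟨s₁, t₁, he, ⟨s₂, t₂, he', hq, hW'⟩, hW⟩ := h
  refine ⟨s₂, _, Exec.seq he he', hq, fun W h1 h2 => ?_⟩
  simp only [Program.width] at h1
  obtain ⟨h3, h4⟩ := hW W (by omega) h2
  obtain ⟨h5, h6⟩ := hW' (W + k) (by omega) h3
  -- The second program starts with numbers of up to `W + k` bits; both parts are charged at the
  -- final length.
  refine ⟨h5.mono (by omega), ?_⟩
  calc t₁ + t₂ ≤ k * (1 + 5 * (W + k)) + k' * (1 + 5 * (W + k + k')) := by gcongr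
    _ ≤ k * (1 + 5 * (W + k + k')) + k' * (1 + 5 * (W + k + k')) := by
      have : W + k ≤ W + k + k' := by omega
      gcongr
    _ = _ := by ring

theorem test_le {s : State} {W i : ℕ} (hi : Nat.size i ≤ W) (h : s.Fits W) :
    bitCost [i, s.mem i] ≤ 1 + 5 * W := by
  have := h.1 i
  simp [bitCost]; omega

theorem WP.ite {i : ℕ} {P P' : Program} {s : State} {k : ℕ} {Q : State → Prop}
    (h : s.mem i ≠ 0 → WP P s k Q) (h' : s.mem i = 0 → WP P' s k Q) :
    WP (.ite i P P') s (k + 1) Q := by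
  have arith : ∀ W c t, c ≤ 1 + 5 * W → t ≤ k * (1 + 5 * (W + k)) →
      c + t ≤ (k + 1) * (1 + 5 * (W + (k + 1))) := by
    intro W c t h1 h2
    nlinarith
  by_cases hi : s.mem i = 0
  · obtain ⟨s', t, he, hq, hW⟩ := h' hi
    refine ⟨s', _, Exec.ite_false hi he, hq, fun W h1 h2 => ?_⟩
    simp only [Program.width] at h1
    obtain ⟨h3, h4⟩ := hW W (by omega) h2
    exact ⟨h3.mono (by omega), arith _ _ _ (test_le (by omega) h2) h4⟩
  · obtain ⟨s', t, he, hq, hW⟩ := h hi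
    refine ⟨s', _, Exec.ite_true hi he, hq, fun W h1 h2 => ?_⟩
    simp only [Program.width] at h1
    obtain ⟨h3, h4⟩ := hW W (by omega) h2
    exact ⟨h3.mono (by omega), arith _ _ _ (test_le (by omega) h2) h4⟩

theorem WP.loop_false {i : ℕ} {P : Program} {s : State} {Q : State → Prop} (hi : s.mem i = 0)
    (h : Q s) : WP (.loop i P) s 1 Q := by
  refine ⟨s, _, Exec.loop_false hi, h, fun W h1 h2 => ⟨h2.mono (by omega), ?_⟩⟩
  simp only [Program.width] at h1
  have := test_le (i := i) (by omega) h2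
  omega

theorem WP.loop_true {i : ℕ} {P : Program} {s : State} {k k' : ℕ} {Q : State → Prop}
    (hi : s.mem i ≠ 0) (h : WP P s k fun s₁ => WP (.loop i P) s₁ k' Q) :
    WP (.loop i P) s (k + 1 + k') Q := by
  obtain ⟨s₁, t₁, he, ⟨s₂, t₂, he', hq, hW'⟩, hW⟩ := h
  refine ⟨s₂, _, Exec.loop_true hi he he', hq, fun W h1 h2 => ?_⟩
  have h1' := h1
  simp only [Program.width] at h1'
  obtain ⟨h3, h4⟩ := hW W (by omega) h2
  obtain ⟨h5, h6⟩ := hW' (W + k) (by omega) h3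
  have h7 := test_le (i := i) (by omega) h2
  refine ⟨h5.mono (by omega), ?_⟩
  calc _ ≤ (1 + 5 * W) + k * (1 + 5 * (W + k)) + k' * (1 + 5 * (W + k + k')) := by gcongr
    _ ≤ (1 + 5 * (W + k + 1 + k')) + k * (1 + 5 * (W + k + 1 + k'))
        + k' * (1 + 5 * (W + k + 1 + k')) := by
      have h8 : W ≤ W + k + 1 + k' := by omega
      have h9 : W + k ≤ W + k + 1 + k' := by omega
      have h10 : W + k + k' ≤ W + k + 1 + k' := by omega
      gcongr 1 + 5 * ?_ + k * (1 + 5 * ?_) + k' * (1 + 5 * ?_)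
    _ = _ := by ring

/-- A loop that runs through a list. -/
theorem WP.loop_list {α : Type*} {i : ℕ} {P : Program} {k : ℕ} (I : List α → State → Prop)
    (hstep : ∀ a l s, I (a :: l) s → s.mem i ≠ 0 ∧ WP P s k (I l))
    (hend : ∀ s, I [] s → s.mem i = 0) :
    ∀ l s, I l s → WP (.loop i P) s (l.length * (k + 1) + 1) (I [])
  | [], s, h => (WP.loop_false (hend s h) h).mono (by simp) fun _ h => h
  | a :: l, s, h => by
    obtain ⟨h1, h2⟩ := hstep a l s h
    refine (WP.loop_true (k' := l.length * (k + 1) + 1) h1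
      (h2.mono le_rfl fun s' hs' => WP.loop_list I hstep hend l s' hs')).mono ?_ fun _ h => h
    simp only [List.length_cons]
    exact le_of_eq (by ring)

/-- A loop that counts down. -/
theorem WP.loop_count {i : ℕ} {P : Program} {k : ℕ} (I : ℕ → State → Prop)
    (hstep : ∀ j s, I (j + 1) s → s.mem i ≠ 0 ∧ WP P s k (I j))
    (hend : ∀ s, I 0 s → s.mem i = 0) :
    ∀ j s, I j s → WP (.loop i P) s (j * (k + 1) + 1) (I 0)
  | 0, s, h => (WP.loop_false (hend s h) h).mono (by simp) fun _ h => h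
  | j + 1, s, h => by
    obtain ⟨h1, h2⟩ := hstep j s h
    refine (WP.loop_true (k' := j * (k + 1) + 1) h1
      (h2.mono le_rfl fun s' hs' => WP.loop_count I hstep hend j s' hs')).mono ?_ fun _ h => h
    exact le_of_eq (by ring)

theorem WP.computes {P : Program} {x y : List ℕ} {k W : ℕ}
    (h : WP P ⟨fun _ => 0, x, []⟩ k fun s => s.out = y) (hx : ∀ a ∈ x, Nat.size a ≤ W) :
    Computes P x y (k * (1 + 5 * (P.width + W + k))) := by
  obtain ⟨s, t, he, hq, hW⟩ := h
  exact ⟨s, t, he, hq, (hW (P.width + W) (by omega)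
    ⟨by simp, fun a ha => (hx a ha).trans (by omega)⟩).2⟩

/-- If `mem i ≠ 0` then `P`. -/
def Program.when (i : ℕ) (P : Program) : Program := .ite i P (.instr (.const i 0))

theorem WP.when {i : ℕ} {P : Program} {s : State} {k : ℕ} {Q : State → Prop}
    (h : s.mem i ≠ 0 → WP P s k Q) (h' : s.mem i = 0 → Q s) :
    WP (.when i P) s (k + 2) Q := by
  refine WP.ite (k := k + 1) (fun hi => (h hi).mono (by omega) fun _ h => h) fun hi =>
    (WP.instr ?_).mono (by omega) fun _ h => h
  -- The idle branch writes `0` into a register that already holds `0`.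
  have : Instr.apply (.const i 0) s = s := by
    simp [Instr.apply, ← hi]
  rw [this]
  exact h' hi

/-- Subtract `mem 18` from `mem i` if `mem i` exceeds `mem 19`. -/
def Program.reduce (i : ℕ) : Program :=
  .seq (.instr (.sub 6 i 19)) (.when 6 (.instr (.sub i i 18)))

theorem WP.reduce {i : ℕ} {m : ℕ → ℕ} {inp out : List ℕ} {Q : State → Prop} (hi : i ≠ 6)
    (h : Q ⟨Function.update (Function.update m 6 (m i - m 19)) i
      (if m i - m 19 = 0 then m i else m i - m 18), inp, out⟩) :
    WP (.reduce i) ⟨m, inp, out⟩ 4 Q := by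
  refine WP.seq (k := 1) (k' := 3) (WP.instr (WP.when (fun h6 => WP.instr ?_) fun h6 => ?_))
  · simp only [Instr.apply, Function.update_self] at h6 ⊢
    rw [if_neg h6] at h
    simpa [Function.update_of_ne hi] using h
  · simp only [Instr.apply, Function.update_self] at h6 ⊢
    rw [if_pos h6] at h
    rwa [Function.update_eq_self_iff.2 (by rw [Function.update_of_ne hi])] at h

/-- `mem i := mem j`, through the register `0`. -/
def Program.move (i j : ℕ) : Program := .seq (.instr (.const 0 0)) (.instr (.add i j 0))

theorem WP.move {i j : ℕ} {m : ℕ → ℕ} {inp out : List ℕ} {Q : State → Prop} (hj : j ≠ 0)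
    (h : Q ⟨Function.update (Function.update m 0 0) i (m j), inp, out⟩) :
    WP (.move i j) ⟨m, inp, out⟩ 2 Q := by
  refine WP.seq (k := 1) (k' := 1) (WP.instr (WP.instr ?_))
  simpa [Instr.apply, Function.update_of_ne hj] using h

end RAM

/-! ## Propagation of labels -/

namespace Propagate

/-- Reduction modulo `d` of a number below `2 * d`. -/
def red (d r : ℕ) : ℕ := if r - (d - 1) = 0 then r else r - d

/-- Treat the directed edge `(u, v, c)`. A label `a` is stored as `a + 1`, and `0` stands for a
label that is not known yet; the second component is the last discrepancy that was found. -/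
def step (d : ℕ) (σ : (ℕ → ℕ) × ℕ) (e : ℕ × ℕ × ℕ) : (ℕ → ℕ) × ℕ :=
  if σ.1 e.1 = 0 then σ else
    let w := red d (e.2.2 + d + 1 - σ.1 e.1) + 1
    if σ.1 e.2.1 = 0 then (Function.update σ.1 e.2.1 w, σ.2) else
      let z := red d (w + d - σ.1 e.2.1)
      if z = 0 then σ else (σ.1, z)

/-- One pass over all the directed edges. -/
def pass (d : ℕ) (E : List (ℕ × ℕ × ℕ)) (σ : (ℕ → ℕ) × ℕ) : (ℕ → ℕ) × ℕ := E.foldl (step d) σ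

/-- Only the vertex `0` is labeled, by `x`. -/
def start (d x : ℕ) : (ℕ → ℕ) × ℕ := (fun v => if v = 0 then red d x + 1 else 0, 0)

/-- The result of `n` passes, after labeling the vertex `0` by `x`. -/
def check (n d : ℕ) (E : List (ℕ × ℕ × ℕ)) (x : ℕ) : (ℕ → ℕ) × ℕ := (pass d E)^[n] (start d x)

/-- For positive `d`, the truncated difference `r - (d - 1)` vanishes iff `r < d`, so it serves as
the comparison; below `2 * d` one subtraction is enough. -/
theorem red_lt {d r : ℕ} (hr : r < 2 * d) : red d r < d := by
  unfold red; split_ifs <;> omega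

theorem red_of_lt {d r : ℕ} (hr : r < d) : red d r = r := by
  unfold red; split_ifs <;> omega

theorem cast_red {d r : ℕ} (hd : 0 < d) : (red d r : ZMod d) = r := by
  unfold red
  split_ifs with h
  · rfl
  · rw [Nat.cast_sub (by omega)]; simp

/-- The machine reduces the tried label in place and remembers the reduced one, which must still be
accepted. -/
theorem check_red {n d x : ℕ} {E : List (ℕ × ℕ × ℕ)} (hx : x < 2 * d) :
    check n d E (red d x) = check n d E x := by
  simp [check, start, red_of_lt (red_lt hx)]

/-! ### One propagation step and its invariants -/

section

variable {d : ℕ} {σ : (ℕ → ℕ) × ℕ} {e : ℕ × ℕ × ℕ}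

theorem step_fst_of_ne_zero {w : ℕ} (h : σ.1 w ≠ 0) : (step d σ e).1 w = σ.1 w := by
  unfold step
  split_ifs with h1 h2 <;> try rfl
  · by_cases hw : w = e.2.1
    · subst hw; contradiction
    · simp [hw]
  · dsimp only; split_ifs <;> rfl

theorem step_fst_target (h : σ.1 e.1 ≠ 0) : (step d σ e).1 e.2.1 ≠ 0 := by
  by_cases h2 : σ.1 e.2.1 = 0
  · simp [step, h, h2]
  · rwa [step_fst_of_ne_zero h2]

/-- A discrepancy may be replaced by another nonzero one but is never cleared. Hence a final `0`
certifies every test made on the way. -/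
theorem step_snd_ne_zero (h : σ.2 ≠ 0) : (step d σ e).2 ≠ 0 := by
  unfold step
  split_ifs with h1 h2 <;> try exact h
  dsimp only; split_ifs with h3
  · exact h
  · exact h3

/-- The labels are at most `d` and the discrepancy is less than `d`. -/
def Small (d : ℕ) (σ : (ℕ → ℕ) × ℕ) : Prop := (∀ w, σ.1 w ≤ d) ∧ σ.2 < d

theorem Small.step (h : Small d σ) (he : e.2.2 < d) : Small d (step d σ e) := by
  have hd : 0 < d := by omega
  unfold Propagate.step
  split_ifs with h1 h2
  · exact h
  · refine ⟨fun w => ?_, h.2⟩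
    by_cases hw : w = e.2.1
    · subst hw
      simp only [Function.update_self]
      exact red_lt (by omega)
    · simpa [hw] using h.1 w
  · dsimp only; split_ifs
    · exact h
    · refine ⟨h.1, red_lt ?_⟩
      have : red d (e.2.2 + d + 1 - σ.1 e.1) < d := red_lt (by omega)
      omega

/-- The label that is stored at `w`. -/
def value (d : ℕ) (σ : (ℕ → ℕ) × ℕ) (w : ℕ) : ZMod d := ((σ.1 w - 1 : ℕ) : ZMod d)

theorem natCast_eq_value {w : ℕ} (h : σ.1 w ≠ 0) : (σ.1 w : ZMod d) = value d σ w + 1 := by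
  unfold value
  rw [Nat.cast_sub (by omega)]; simp

/-- The stored number is the label plus one, which the `+ 1` compensates; the added `d` keeps the
truncated subtraction exact, because stored numbers are at most `d`. -/
theorem cast_forced (hd : 0 < d) (h : Small d σ) (h1 : σ.1 e.1 ≠ 0) :
    (red d (e.2.2 + d + 1 - σ.1 e.1) : ZMod d) = e.2.2 - value d σ e.1 := by
  have := h.1 e.1
  rw [cast_red hd, Nat.cast_sub (by omega)]
  push_cast
  rw [natCast_eq_value h1]
  simp

theorem cast_discrepancy (hd : 0 < d) (h : Small d σ) (h1 : σ.1 e.1 ≠ 0) (h2 : σ.1 e.2.1 ≠ 0) :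
    (red d (red d (e.2.2 + d + 1 - σ.1 e.1) + 1 + d - σ.1 e.2.1) : ZMod d) =
      e.2.2 - value d σ e.1 - value d σ e.2.1 := by
  have := h.1 e.2.1
  rw [cast_red hd, Nat.cast_sub (by omega)]
  push_cast
  rw [cast_forced hd h h1, natCast_eq_value h2]
  simp

theorem step_snd_eq_zero (h : Small d σ) (he : e.2.2 < d) (h0 : (step d σ e).2 = 0)
    (h1 : σ.1 e.1 ≠ 0) (h2 : σ.1 e.2.1 ≠ 0) :
    (e.2.2 : ZMod d) = value d σ e.1 + value d σ e.2.1 := by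
  have hd : 0 < d := by omega
  have key := cast_discrepancy hd h h1 h2
  simp only [step, if_neg h1, if_neg h2] at h0
  have hz : red d (red d (e.2.2 + d + 1 - σ.1 e.1) + 1 + d - σ.1 e.2.1) = 0 := by
    split_ifs at h0 with h3
    · exact h3
    · exact absurd h0 h3
  rw [hz] at key
  have : (e.2.2 : ZMod d) = (e.2.2 - value d σ e.1 - value d σ e.2.1)
    + (value d σ e.1 + value d σ e.2.1) := by ring
  rw [this, ← key]; simp

/-- The known labels differ by `t` or `-t` from those of `f`, the discrepancy is `0` or
`2 * t` or `-2 * t`. -/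
def Near (f : ℕ → ZMod d) (t : ZMod d) (σ : (ℕ → ℕ) × ℕ) : Prop :=
  (∀ w, σ.1 w ≠ 0 → f w = value d σ w + t ∨ f w = value d σ w - t) ∧
    (σ.2 = 0 ∨ (σ.2 : ZMod d) = 2 * t ∨ (σ.2 : ZMod d) = -(2 * t))

/-- If `f u = a + t`, the value `c - a` propagated to `v` satisfies `f v = (c - a) - t`, and
symmetrically: the sign flips. At an edge with both ends known, `c - a - b` is the sum of the two
deviations, each `t` or `-t`. -/
theorem Near.step {f : ℕ → ZMod d} {t : ZMod d} (h : Near f t σ) (hs : Small d σ)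
    (he : e.2.2 < d) (hf : (e.2.2 : ZMod d) = f e.1 + f e.2.1) : Near f t (step d σ e) := by
  have hd : 0 < d := by omega
  by_cases h1 : σ.1 e.1 = 0
  · simpa [Propagate.step, h1] using h
  by_cases h2 : σ.1 e.2.1 = 0
  · refine ⟨fun w hw => ?_, ?_⟩
    · by_cases hwe : w = e.2.1
      · have hv : value d (Propagate.step d σ e) w = e.2.2 - value d σ e.1 := by
          rw [← cast_forced hd hs h1]
          simp [value, Propagate.step, h1, h2, hwe]
        rw [hv, hf, hwe]
        rcases h.1 _ h1 with h3 | h3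
        · right; rw [h3]; ring
        · left; rw [h3]; ring
      · have hv : (Propagate.step d σ e).1 w = σ.1 w := by
          simp [Propagate.step, h1, h2, hwe]
        rw [value, hv]
        exact h.1 w (hv ▸ hw)
    · simpa [Propagate.step, h1, h2] using h.2
  · have key := cast_discrepancy hd hs h1 h2
    have hv : (Propagate.step d σ e).1 = σ.1 := by
      simp only [Propagate.step, h1, h2, if_false]
      split_ifs <;> rfl
    refine ⟨fun w hw => ?_, ?_⟩
    · rw [value, hv]
      exact h.1 w (hv ▸ hw)
    · simp only [Propagate.step, h1, h2, if_false]
      split_ifs with h3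
      · exact h.2
      · dsimp only
        -- With opposite signs the discrepancy vanishes modulo `d`, and being below `d` it is then
        -- `0` itself.
        have h0 : (red d (red d (e.2.2 + d + 1 - σ.1 e.1) + 1 + d - σ.1 e.2.1) : ZMod d) = 0 →
            red d (red d (e.2.2 + d + 1 - σ.1 e.1) + 1 + d - σ.1 e.2.1) = 0 := by
          intro h4
          rw [ZMod.natCast_eq_zero_iff] at h4
          refine Nat.eq_zero_of_dvd_of_lt h4 (red_lt ?_)
          have : red d (e.2.2 + d + 1 - σ.1 e.1) < d := red_lt (by omega)
          omega
        rw [key] at h0 ⊢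
        rw [hf] at h0 ⊢
        rcases h.1 _ h1 with h4 | h4 <;> rcases h.1 _ h2 with h5 | h5 <;> rw [h4, h5] at h0 ⊢
        · right; left; ring
        · left; exact h0 (by ring)
        · left; exact h0 (by ring)
        · right; right; ring

end

/-! ### Passes over all edges -/

section

variable {d : ℕ} {E : List (ℕ × ℕ × ℕ)}

theorem pass_fst_of_ne_zero {w : ℕ} : ∀ {E : List (ℕ × ℕ × ℕ)} {σ : (ℕ → ℕ) × ℕ}, σ.1 w ≠ 0 →
    (pass d E σ).1 w = σ.1 w
  | [], _, _ => rfl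
  | e :: E, σ, h => by
    have h1 : (step d σ e).1 w = σ.1 w := step_fst_of_ne_zero h
    rw [← h1]
    exact pass_fst_of_ne_zero (E := E) (σ := step d σ e) (by rwa [h1])

theorem pass_fst_target : ∀ {E : List (ℕ × ℕ × ℕ)} {σ : (ℕ → ℕ) × ℕ} {e : ℕ × ℕ × ℕ}, e ∈ E →
    σ.1 e.1 ≠ 0 → (pass d E σ).1 e.2.1 ≠ 0
  | a :: E, σ, e, he, h => by
    change (pass d E (step d σ a)).1 e.2.1 ≠ 0
    rcases List.mem_cons.1 he with rfl | he
    · rw [pass_fst_of_ne_zero (step_fst_target h)]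
      exact step_fst_target h
    · refine pass_fst_target he ?_
      rwa [step_fst_of_ne_zero h]

theorem pass_snd_ne_zero : ∀ {E : List (ℕ × ℕ × ℕ)} {σ : (ℕ → ℕ) × ℕ}, σ.2 ≠ 0 →
    (pass d E σ).2 ≠ 0
  | [], _, h => h
  | e :: E, σ, h => pass_snd_ne_zero (E := E) (σ := step d σ e) (step_snd_ne_zero h)

theorem Small.pass (hE : ∀ e ∈ E, e.2.2 < d) {σ : (ℕ → ℕ) × ℕ} (h : Small d σ) :
    Small d (pass d E σ) := by
  induction E generalizing σ with
  | nil => exact h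
  | cons e E ih =>
    exact ih (fun e' he' => hE e' (by simp [he'])) (h.step (hE e (by simp)))

theorem Near.pass {f : ℕ → ZMod d} {t : ZMod d} (hE : ∀ e ∈ E, e.2.2 < d)
    (hf : ∀ e ∈ E, (e.2.2 : ZMod d) = f e.1 + f e.2.1) {σ : (ℕ → ℕ) × ℕ}
    (h : Near f t σ) (hs : Small d σ) : Near f t (pass d E σ) := by
  induction E generalizing σ with
  | nil => exact h
  | cons e E ih =>
    exact ih (fun e' he' => hE e' (by simp [he'])) (fun e' he' => hf e' (by simp [he']))
      (h.step hs (hE e (by simp)) (hf e (by simp))) (hs.step (hE e (by simp)))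

/-- Labels known before the pass do not change during it, so the test made when `e` is reached
concerns these same values. -/
theorem pass_snd_eq_zero (hE : ∀ e ∈ E, e.2.2 < d) {σ : (ℕ → ℕ) × ℕ} (hs : Small d σ)
    (h0 : (pass d E σ).2 = 0) {e : ℕ × ℕ × ℕ} (he : e ∈ E) (h1 : σ.1 e.1 ≠ 0)
    (h2 : σ.1 e.2.1 ≠ 0) : (e.2.2 : ZMod d) = value d σ e.1 + value d σ e.2.1 := by
  induction E generalizing σ with
  | nil => simp at he
  | cons a E ih =>
    have ha := hE a (by simp)
    change (Propagate.pass d E (step d σ a)).2 = 0 at h0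
    rcases List.mem_cons.1 he with rfl | he
    · exact step_snd_eq_zero hs ha (not_imp_not.1 pass_snd_ne_zero h0) h1 h2
    · have := ih (fun e' he' => hE e' (by simp [he'])) (hs.step ha) h0 he
        (by rwa [step_fst_of_ne_zero h1]) (by rwa [step_fst_of_ne_zero h2])
      simpa only [value, step_fst_of_ne_zero h1, step_fst_of_ne_zero h2] using this

theorem Small.start {x : ℕ} (hx : x < 2 * d) : Small d (start d x) := by
  refine ⟨fun w => ?_, by simp only [Propagate.start]; omega⟩
  have := red_lt hx
  simp only [Propagate.start]
  split_ifs <;> omega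

theorem Near.start {f : ℕ → ZMod d} {x : ℕ} (hx : x < 2 * d) : Near f (f 0 - x) (start d x) := by
  have hd : 0 < d := by omega
  refine ⟨fun w hw => ?_, Or.inl rfl⟩
  by_cases h : w = 0
  · left
    subst h
    simp [value, Propagate.start, cast_red hd]
  · simp [Propagate.start, h] at hw

theorem small_iterate (hE : ∀ e ∈ E, e.2.2 < d) {x : ℕ} (hx : x < 2 * d) (k : ℕ) :
    Small d ((pass d E)^[k] (start d x)) := by
  induction k with
  | zero => exact Small.start hx
  | succ k ih => rw [Function.iterate_succ_apply']; exact ih.pass hE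

theorem near_check (hE : ∀ e ∈ E, e.2.2 < d) {f : ℕ → ZMod d}
    (hf : ∀ e ∈ E, (e.2.2 : ZMod d) = f e.1 + f e.2.1) {x : ℕ} (hx : x < 2 * d) (n : ℕ) :
    Near f (f 0 - x) (check n d E x) := by
  unfold check
  induction n with
  | zero => exact Near.start hx
  | succ k ih =>
    rw [Function.iterate_succ_apply']
    exact ih.pass hE hf (small_iterate hE hx k)

theorem iterate_fst_zero {x : ℕ} (k : ℕ) : ((pass d E)^[k] (start d x)).1 0 = red d x + 1 := by
  induction k with
  | zero => simp [start]
  | succ k ih =>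
    rw [Function.iterate_succ_apply', pass_fst_of_ne_zero (by rw [ih]; omega), ih]

end

end Propagate

/-! ## Labelings with a prescribed label at one vertex -/

section Labelings

variable {V : Type*} {d : ℕ} {G : SimpleGraph V} {fE : G.edgeSet → ZMod d}

/-- Equality travels along a walk to `r`, since an edge and the value at one end determine the value
at the other. -/
theorem IsValidVLabeling.eq_of_eq {f g : V → ZMod d} (hG : G.Connected)
    (hf : IsValidVLabeling G fE f) (hg : IsValidVLabeling G fE g) {r : V} (h : f r = g r) :
    f = g := by
  funext v
  obtain ⟨p⟩ := hG.preconnected v r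
  induction p with
  | nil => exact h
  | cons huv p ih =>
    have h1 := hf _ _ huv
    rw [hg _ _ huv, ih h] at h1
    exact (add_right_cancel h1).symm

theorem IsValidVLabeling.add_smul_sub {f g : V → ZMod d} (hf : IsValidVLabeling G fE f)
    (hg : IsValidVLabeling G fE g) (k : ZMod d) :
    IsValidVLabeling G fE fun v => f v + k * (g v - f v) := by
  intro u v h
  have h1 := hf u v h
  have h2 := hg u v h
  have h3 : g u + g v = f u + f v := by rw [← h1, ← h2]
  rw [h1]
  linear_combination (-k) * h3

/-- If two labelings differ by `t` at a vertex `r` and `2 * t ≠ 0`, there is a labeling with any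
given label at `r`. -/
theorem IsValidVLabeling.exists_of_two_mul_ne_zero {f g : V → ZMod d} (hG : G.Connected)
    (hf : IsValidVLabeling G fE f) (hg : IsValidVLabeling G fE g) {r : V}
    (h : 2 * (g r - f r) ≠ 0) (x : ZMod d) : ∃ f', IsValidVLabeling G fE f' ∧ f' r = x := by
  classical
  set t := g r - f r with ht
  have hne : t ≠ -t := fun h' => h (by rw [two_mul]; nth_rewrite 2 [h']; ring)
  have hadj : ∀ u v, G.Adj u v → (g u - f u) + (g v - f v) = 0 := by
    intro u v huv
    have h1 := hf u v huv
    rw [hg u v huv] at h1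
    linear_combination h1
  have hpm : ∀ v, g v - f v = t ∨ g v - f v = -t := by
    intro v
    obtain ⟨p⟩ := hG.preconnected v r
    induction p with
    | nil => exact Or.inl ht.symm
    | cons huv p ih =>
      have h1 := hadj _ _ huv
      rcases ih h ht hne with h2 | h2
      · right; linear_combination h1 - h2
      · left; linear_combination h1 - h2
  -- Since `t ≠ -t`, the sign is well defined. It alternates along edges, so multiples of `s` can be
  -- added to `f` without changing edge sums.
  let s : V → ZMod d := fun v => if g v - f v = t then 1 else -1
  refine ⟨fun v => f v + (x - f r) * s v, fun u v huv => ?_, by simp [s, ← ht]⟩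
  have hs : s u + s v = 0 := by
    have h1 := hadj u v huv
    rcases hpm u with h2 | h2
    · have h3 : g v - f v = -t := by linear_combination h1 - h2
      simp [s, h2, h3, hne.symm]
    · have h3 : g v - f v = t := by linear_combination h1 - h2
      simp [s, h2, h3, hne.symm]
  rw [hf u v huv]
  linear_combination (-(x - f r)) * hs

end Labelings

/-! ## Propagation decides additivity -/

/-- The edges in both orientations, with natural numbers as labels. -/
def directedEdges {n d : ℕ} (L : List (Fin n × Fin n × ZMod d)) : List (ℕ × ℕ × ℕ) :=
  L.flatMap fun x => [(x.1.val, x.2.1.val, x.2.2.val), (x.2.1.val, x.1.val, x.2.2.val)]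

theorem ListsEdges.mem_directedEdges {n d : ℕ} {G : SimpleGraph (Fin n)} {fE : G.edgeSet → ZMod d}
    {L : List (Fin n × Fin n × ZMod d)} (hL : ListsEdges G fE L) {e : ℕ × ℕ × ℕ} :
    e ∈ directedEdges L ↔
      ∃ (u v : Fin n) (h : G.Adj u v), e = (u.val, v.val, (fE ⟨s(u, v), h⟩).val) := by
  have key := hL.2
  simp only [directedEdges, List.mem_flatMap, List.mem_cons, List.not_mem_nil, or_false]
  constructor
  · rintro ⟨⟨u, v, c⟩, hx, rfl | rfl⟩
    · obtain ⟨h, hc⟩ := (key u v c).1 (Or.inl hx)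
      exact ⟨u, v, h, by rw [hc]⟩
    · obtain ⟨h, hc⟩ := (key v u c).1 (Or.inr hx)
      exact ⟨v, u, h, by rw [hc]⟩
  · rintro ⟨u, v, h, rfl⟩
    rcases (key u v _).2 ⟨h, rfl⟩ with hx | hx
    · exact ⟨_, hx, Or.inl rfl⟩
    · exact ⟨_, hx, Or.inr rfl⟩

theorem ListsEdges.length_eq {n d : ℕ} {G : SimpleGraph (Fin n)} {fE : G.edgeSet → ZMod d}
    {L : List (Fin n × Fin n × ZMod d)} (hL : ListsEdges G fE L) :
    L.length = Nat.card G.edgeSet := by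
  classical
  have h : G.edgeSet = ((L.map fun x => s(x.1, x.2.1)).toFinset : Set (Sym2 (Fin n))) := by
    ext e
    induction e using Sym2.ind with
    | _ u v =>
      simp only [SimpleGraph.mem_edgeSet, List.coe_toFinset, List.mem_map, Set.mem_ofPred_eq]
      constructor
      · intro h
        rcases (hL.2 u v _).2 ⟨h, rfl⟩ with hx | hx
        · exact ⟨_, hx, rfl⟩
        · exact ⟨_, hx, Sym2.eq_swap⟩
      · rintro ⟨⟨a, b, c⟩, hx, he⟩
        rw [← SimpleGraph.mem_edgeSet, ← he, SimpleGraph.mem_edgeSet]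
        exact ((hL.2 a b c).1 (Or.inl hx)).1
  rw [h, Nat.card_coe_set_eq, Set.ncard_coe_finset, List.toFinset_card_of_nodup hL.1,
    List.length_map]

namespace Propagate

/-- The labeling found by `check`. -/
def labeling (n d : ℕ) (E : List (ℕ × ℕ × ℕ)) (x : ℕ) : Fin n → ZMod d :=
  fun v => value d (check n d E x) v

/-- The possible labels of the vertex `0`, given a discrepancy `e` for the label `0`. -/
def candidates (d e : ℕ) : List ℕ := [e / 2, (e + d) / 2, (d - e) / 2, (d + d - e) / 2]

/-- The labels of the vertex `0` to be tried, if `y` is known to be one that works. -/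
def starts (n d : ℕ) (E : List (ℕ × ℕ × ℕ)) (y : ℕ) : List ℕ :=
  if (check n d E (y + 1)).2 = 0 then (List.range d).reverse else [y, y + d / 2]

/-- The labelings that are found from the list `l` of labels of the vertex `0`. -/
def labelings (n d : ℕ) (E : List (ℕ × ℕ × ℕ)) (l : List ℕ) : List (Fin n → ZMod d) :=
  (l.filter fun x => (check n d E x).2 = 0).map (labeling n d E)

section

variable {n d : ℕ} {G : SimpleGraph (Fin n)} {fE : G.edgeSet → ZMod d}
  {L : List (Fin n × Fin n × ZMod d)} (hd : 0 < d) (hn : 0 < n) (hG : G.Connected)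
  (hL : ListsEdges G fE L)

include hd hL in
theorem label_lt : ∀ e ∈ directedEdges L, e.2.2 < d := by
  have : NeZero d := ⟨hd.ne'⟩
  intro e he
  obtain ⟨u, v, h, rfl⟩ := hL.mem_directedEdges.1 he
  exact ZMod.val_lt _

/-- Each pass advances at least one edge along the walk, whatever the order of the edge list. -/
theorem iterate_ne_zero_of_walk (hL : ListsEdges G fE L) (x k : ℕ) {r v : Fin n} (p : G.Walk r v)
    (hr : ((pass d (directedEdges L))^[k] (start d x)).1 r ≠ 0) :
    ((pass d (directedEdges L))^[k + p.length] (start d x)).1 v ≠ 0 := by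
  induction p generalizing k with
  | nil => exact hr
  | cons huv p ih =>
    have := ih (k + 1) (by
      rw [Function.iterate_succ_apply']
      exact pass_fst_target (hL.mem_directedEdges.2 ⟨_, _, huv, rfl⟩) hr)
    rwa [add_assoc, add_comm 1] at this

include hn hG hL in
theorem iterate_ne_zero (x : ℕ) {k : ℕ} (hk : n ≤ k + 1) (v : Fin n) :
    ((pass d (directedEdges L))^[k] (start d x)).1 v ≠ 0 := by
  obtain ⟨p, hp⟩ := (hG.preconnected ⟨0, hn⟩ v).exists_isPath
  have hlen := hp.length_lt
  rw [Fintype.card_fin] at hlen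
  obtain ⟨j, rfl⟩ : ∃ j, k = j + p.length := ⟨k - p.length, by omega⟩
  exact iterate_ne_zero_of_walk hL x j p (by simp [iterate_fst_zero])

include hn hG hL in
theorem check_ne_zero (x : ℕ) (v : Fin n) : (check n d (directedEdges L) x).1 v ≠ 0 :=
  iterate_ne_zero hn hG hL x (by omega) v

include hd hL in
theorem val_labeling {x : ℕ} (hx : x < 2 * d) (v : Fin n)
    (_h : (check n d (directedEdges L) x).1 v ≠ 0) :
    (labeling n d (directedEdges L) x v).val = (check n d (directedEdges L) x).1 v - 1 := by
  have := (small_iterate (label_lt hd hL) hx n).1 v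
  change (check n d (directedEdges L) x).1 v ≤ d at this
  rw [labeling, value, ZMod.val_natCast, Nat.mod_eq_of_lt (by omega)]

include hd hn in
theorem labeling_zero (x : ℕ) : labeling n d (directedEdges L) x ⟨0, hn⟩ = x := by
  simp only [labeling, value, check, iterate_fst_zero, Nat.add_sub_cancel, cast_red hd]

include hd hn hG hL in
-- With `n = k + 1`, the first `k` passes label all vertices; the last pass changes no label and
-- tests all edges.
theorem valid_labeling {x : ℕ} (hx : x < 2 * d) (h : (check n d (directedEdges L) x).2 = 0) :
    IsValidVLabeling G fE (labeling n d (directedEdges L) x) := by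
  have : NeZero d := ⟨hd.ne'⟩
  obtain ⟨k, rfl⟩ : ∃ k, n = k + 1 := ⟨n - 1, by omega⟩
  have hne := fun v => iterate_ne_zero (d := d) hn hG hL x le_rfl v
  have hlab : ∀ v : Fin (k + 1), labeling (k + 1) d (directedEdges L) x v =
      value d ((pass d (directedEdges L))^[k] (start d x)) v := by
    intro v
    simp only [labeling, value, check, Function.iterate_succ_apply']
    rw [pass_fst_of_ne_zero (hne v)]
  intro u v huv
  rw [check, Function.iterate_succ_apply'] at h
  have := pass_snd_eq_zero (label_lt hd hL) (small_iterate (label_lt hd hL) hx k) h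
    (hL.mem_directedEdges.2 ⟨u, v, huv, rfl⟩) (hne u) (hne v)
  rw [hlab, hlab, ← this]
  simp

/-- A labeling, extended to all natural numbers. -/
def extend (f : Fin n → ZMod d) (v : ℕ) : ZMod d := if h : v < n then f ⟨v, h⟩ else 0

theorem extend_val (f : Fin n → ZMod d) (v : Fin n) : extend f v = f v := by simp [extend]

include hd hL in
theorem near_check_of_valid {f : Fin n → ZMod d} (hf : IsValidVLabeling G fE f) {x : ℕ}
    (hx : x < 2 * d) :
    Near (extend f) (extend f 0 - x) (check n d (directedEdges L) x) := by
  have : NeZero d := ⟨hd.ne'⟩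
  refine near_check (label_lt hd hL) ?_ hx n
  intro e he
  obtain ⟨u, v, h, rfl⟩ := hL.mem_directedEdges.1 he
  simpa [extend_val] using hf u v h

include hd hn hG hL in
-- This is `Near` with `t = 0`: the discrepancy is `0` modulo `d` and below `d`. The labeling found
-- is then `f` by uniqueness.
theorem check_of_valid {f : Fin n → ZMod d} (hf : IsValidVLabeling G fE f) {x : ℕ}
    (hx : x < 2 * d) (h : f ⟨0, hn⟩ = x) :
    (check n d (directedEdges L) x).2 = 0 ∧ labeling n d (directedEdges L) x = f := by
  have hne := near_check_of_valid hd hL hf hx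
  have h0 : extend f 0 - x = 0 := by
    rw [extend, dif_pos hn, h, sub_self]
  rw [h0] at hne
  have hok : (check n d (directedEdges L) x).2 = 0 := by
    rcases hne.2 with h1 | h1 | h1
    · exact h1
    all_goals
      simp only [mul_zero, neg_zero] at h1
      rw [ZMod.natCast_eq_zero_iff] at h1
      exact Nat.eq_zero_of_dvd_of_lt h1 (small_iterate (label_lt hd hL) hx n).2
  refine ⟨hok, ?_⟩
  exact (valid_labeling hd hn hG hL hx hok).eq_of_eq hG hf
    (r := ⟨0, hn⟩) (by rw [labeling_zero hd hn, h])

include hd hn hG hL in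
theorem check_iff {x : ℕ} (hx : x < 2 * d) : (check n d (directedEdges L) x).2 = 0 ↔
    ∃ f, IsValidVLabeling G fE f ∧ f ⟨0, hn⟩ = x :=
  ⟨fun h => ⟨_, valid_labeling hd hn hG hL hx h, labeling_zero hd hn x⟩,
    fun ⟨_, hf, h⟩ => (check_of_valid hd hn hG hL hf hx h).1⟩

/-! ### Finitely many candidates decide additivity -/

theorem candidates_lt {e : ℕ} (he : e < d) : ∀ x ∈ candidates d e, x < 2 * d := by
  simp only [candidates, List.mem_cons, List.not_mem_nil, or_false]
  omega

/-- Since `e, x < d`, the congruences leave only `2 * x = e`, `2 * x = e + d`, or `2 * x + e` equal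
to `0`, `d` or `2 * d`; the value `0` forces `x = e = 0`. Halving with a wrong parity only adds
candidates, which is harmless because every candidate is checked. -/
theorem mem_candidates {e x : ℕ} (he : e < d) (hx : x < d)
    (h : (e : ZMod d) = 2 * x ∨ (e : ZMod d) = -(2 * x)) : x ∈ candidates d e := by
  simp only [candidates, List.mem_cons, List.not_mem_nil, or_false]
  rcases h with h | h
  · have h1 : ((2 * x : ℕ) : ZMod d) = (e : ℕ) := by push_cast; exact h.symm
    rw [ZMod.natCast_eq_natCast_iff, Nat.ModEq, Nat.mod_eq_of_lt he] at h1
    have h2 := Nat.div_add_mod (2 * x) d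
    have h3 : 2 * x / d < 2 := Nat.div_lt_of_lt_mul (by omega)
    rw [h1] at h2
    interval_cases 2 * x / d <;> omega
  · have h1 : ((2 * x + e : ℕ) : ZMod d) = 0 := by push_cast; rw [h]; ring
    rw [ZMod.natCast_eq_zero_iff] at h1
    obtain ⟨k, hk⟩ := h1
    have h3 : k < 3 := by
      by_contra h4
      have : d * 3 ≤ d * k := Nat.mul_le_mul_left _ (by omega)
      omega
    interval_cases k <;> omega

include hd hn hG hL in
theorem isAdditive_iff : IsAdditive G fE ↔
    ∃ x ∈ candidates d (check n d (directedEdges L) 0).2,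
      (check n d (directedEdges L) x).2 = 0 := by
  have : NeZero d := ⟨hd.ne'⟩
  have hlt : (check n d (directedEdges L) 0).2 < d :=
    (small_iterate (label_lt hd hL) (by omega) n).2
  constructor
  · rintro ⟨f, hf⟩
    have hx : (f ⟨0, hn⟩).val < d := ZMod.val_lt _
    have hok := (check_of_valid hd hn hG hL hf (x := (f ⟨0, hn⟩).val) (by omega) (by simp)).1
    have hnear := (near_check_of_valid hd hL hf (x := 0) (by omega)).2
    have hext : extend f 0 - ((0 : ℕ) : ZMod d) = ((f ⟨0, hn⟩).val : ℕ) := by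
      simp [extend, hn]
    rw [hext] at hnear
    rcases hnear with h | h
    · exact ⟨0, by simp [candidates, h], h⟩
    · exact ⟨_, mem_candidates hlt hx h, hok⟩
  · rintro ⟨x, hx, h⟩
    exact ⟨_, valid_labeling hd hn hG hL (candidates_lt hlt x hx) h⟩

/-! ### All labelings from one -/

theorem starts_lt {y : ℕ} {E : List (ℕ × ℕ × ℕ)} (hy : y < d) :
    ∀ x ∈ starts n d E y, x < 2 * d := by
  unfold starts
  split_ifs
  · simp; omega
  · simp; omega

include hd hn hG hL in
theorem card_of_two {y : ℕ} (hy : y < d) (h : (check n d (directedEdges L) y).2 = 0)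
    (h' : (check n d (directedEdges L) (y + 1)).2 = 0) :
    (∀ x, ∃ f, IsValidVLabeling G fE f ∧ f ⟨0, hn⟩ = x) ∧ d ≤ numValid G fE := by
  have : NeZero d := ⟨hd.ne'⟩
  obtain ⟨f, hf, hf0⟩ := (check_iff hd hn hG hL (by omega)).1 h
  obtain ⟨g, hg, hg0⟩ := (check_iff hd hn hG hL (by omega)).1 h'
  have hall : ∀ x, ∃ f, IsValidVLabeling G fE f ∧ f ⟨0, hn⟩ = x := fun x =>
    ⟨_, hf.add_smul_sub hg (x - f ⟨0, hn⟩), by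
      simp only [hf0, hg0]; push_cast; ring⟩
  refine ⟨hall, ?_⟩
  have hsurj : Function.Surjective
      fun f : {fV : Fin n → ZMod d // IsValidVLabeling G fE fV} => f.1 ⟨0, hn⟩ := fun x => by
    obtain ⟨f, hf, h⟩ := hall x
    exact ⟨⟨f, hf⟩, h⟩
  have := Nat.card_le_card_of_surjective _ hsurj
  simpa [numValid] using this

include hd hn hG hL in
theorem mem_labelings {l : List ℕ} (hl : ∀ x ∈ l, x < 2 * d)
    (h : ∀ f, IsValidVLabeling G fE f → ∃ x ∈ l, f ⟨0, hn⟩ = x) (f : Fin n → ZMod d) :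
    f ∈ labelings n d (directedEdges L) l ↔ IsValidVLabeling G fE f := by
  simp only [labelings, List.mem_map, List.mem_filter, decide_eq_true_eq]
  constructor
  · rintro ⟨x, ⟨hx, hok⟩, rfl⟩
    exact valid_labeling hd hn hG hL (hl x hx) hok
  · intro hf
    obtain ⟨x, hx, hfx⟩ := h f hf
    obtain ⟨h1, h2⟩ := check_of_valid hd hn hG hL hf (hl x hx) hfx
    exact ⟨x, ⟨hx, h1⟩, h2⟩

include hd hn in
-- The value at vertex `0` recovers the residue from which a labeling was propagated.
theorem nodup_labelings {l : List ℕ} (hl : (l.map fun x : ℕ => (x : ZMod d)).Nodup) :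
    (labelings n d (directedEdges L) l).Nodup := by
  refine List.Nodup.of_map (fun f => f ⟨0, hn⟩) ?_
  rw [labelings, List.map_map]
  have : ((fun f : Fin n → ZMod d => f ⟨0, hn⟩) ∘ labeling n d (directedEdges L)) =
      fun x : ℕ => (x : ZMod d) := by
    funext x
    exact labeling_zero hd hn x
  rw [this]
  exact hl.sublist (List.filter_sublist.map _)

include hd hn hG hL in
theorem labelings_starts {y : ℕ} (hy : y < d) (h : (check n d (directedEdges L) y).2 = 0) :
    (labelings n d (directedEdges L) (starts n d (directedEdges L) y)).Nodup ∧
      ∀ f, f ∈ labelings n d (directedEdges L) (starts n d (directedEdges L) y) ↔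
        IsValidVLabeling G fE f := by
  have : NeZero d := ⟨hd.ne'⟩
  by_cases h' : (check n d (directedEdges L) (y + 1)).2 = 0
  · refine ⟨nodup_labelings hd hn ?_, mem_labelings hd hn hG hL (starts_lt hy) ?_⟩
    · rw [starts, if_pos h', List.map_reverse, List.nodup_reverse,
        List.nodup_map_iff_inj_on List.nodup_range]
      intro a ha b hb hab
      rw [List.mem_range] at ha hb
      rw [ZMod.natCast_eq_natCast_iff, Nat.ModEq, Nat.mod_eq_of_lt ha, Nat.mod_eq_of_lt hb] at hab
      exact hab
    · intro f _
      rw [starts, if_pos h']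
      exact ⟨(f ⟨0, hn⟩).val, by simp [ZMod.val_lt], by simp⟩
  -- A difference with nonzero double would yield a labeling with value `y + 1` at vertex `0`, which
  -- was rejected.
  · have hnot : ∀ z : ZMod d, (∃ f, IsValidVLabeling G fE f ∧ f ⟨0, hn⟩ = z) →
        2 * (z - y) = 0 := by
      rintro z ⟨g, hg, rfl⟩
      obtain ⟨f, hf, hf0⟩ := (check_iff hd hn hG hL (by omega)).1 h
      by_contra hne
      rw [← hf0] at hne
      exact h' ((check_iff hd hn hG hL (by omega)).2
        (hf.exists_of_two_mul_ne_zero hG hg hne _))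
    -- For `d = 1` the residues of `y` and `y + 1` coincide. Excluding this case makes `d / 2`
    -- nonzero modulo `d`.
    have hd2 : 2 ≤ d := by
      by_contra hd2
      obtain rfl : d = 1 := by omega
      obtain ⟨f, hf, -⟩ := (check_iff hd hn hG hL (by omega)).1 h
      exact h' ((check_iff hd hn hG hL (by omega)).2 ⟨f, hf, Subsingleton.elim _ _⟩)
    refine ⟨nodup_labelings hd hn ?_, mem_labelings hd hn hG hL (starts_lt hy) ?_⟩
    · rw [starts, if_neg h']
      have : ((d / 2 : ℕ) : ZMod d) ≠ 0 := by
        rw [Ne, ZMod.natCast_eq_zero_iff]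
        intro hdvd
        have := Nat.le_of_dvd (by omega) hdvd
        omega
      simpa using this
    · intro f hf
      have h2 := hnot _ ⟨f, hf, rfl⟩
      rw [starts, if_neg h']
      set t := f ⟨0, hn⟩ - y with ht
      have hlt : t.val < d := ZMod.val_lt t
      have h3 : ((2 * t.val : ℕ) : ZMod d) = 0 := by simpa using h2
      rw [ZMod.natCast_eq_zero_iff] at h3
      obtain ⟨k, hk⟩ := h3
      -- From `2 * t.val = d * k` and `t.val < d`: either `t.val = 0`, or `d` is even and `t.val = d
      -- / 2`.
      have hk2 : k < 2 := by
        by_contra h4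
        have : d * 2 ≤ d * k := Nat.mul_le_mul_left _ (by omega)
        omega
      have hft : f ⟨0, hn⟩ = y + (t.val : ℕ) := by
        rw [ZMod.natCast_zmod_val, ht]; ring
      interval_cases k
      · refine ⟨y, by simp, ?_⟩
        rw [hft, show t.val = 0 by omega]; simp
      · refine ⟨y + d / 2, by simp, ?_⟩
        rw [hft, show t.val = d / 2 by omega]; simp

end

end Propagate

/-! ## Programs for the propagation of labels -/

namespace RAM

open Propagate

/-- A nonempty sequence of instructions. -/
def Program.block : Instr → List Instr → Program
  | a, [] => .instr a
  | a, b :: l => .seq (.instr a) (.block b l)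

theorem WP.block {a : Instr} {l : List Instr} {s : State} {Q : State → Prop}
    (h : Q (l.foldl (fun s b => b.apply s) (a.apply s))) : WP (.block a l) s (l.length + 1) Q := by
  induction l generalizing a s with
  | nil => exact WP.instr h
  | cons b l ih => exact (WP.seq (WP.instr (ih h))).mono (by simp; omega) fun _ h => h

/-- The directed edges `l` are stored from the register `p` on. -/
def Stored (m : ℕ → ℕ) : ℕ → List (ℕ × ℕ × ℕ) → Prop
  | _, [] => True
  | p, e :: l => m p = 32 + e.1 ∧ m (p + 1) = 32 + e.2.1 ∧ m (p + 2) = e.2.2 ∧ Stored m (p + 3) l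

theorem Stored.congr {m m' : ℕ → ℕ} : ∀ {p : ℕ} {l : List (ℕ × ℕ × ℕ)}, Stored m p l →
    (∀ r, p ≤ r → r < p + 3 * l.length → m' r = m r) → Stored m' p l
  | _, [], _, _ => trivial
  | p, e :: l, ⟨h1, h2, h3, h4⟩, h => by
    rw [List.length_cons] at h
    refine ⟨?_, ?_, ?_, h4.congr fun r hr hr' => h r (by omega) (by omega)⟩
    · rw [h _ (by omega) (by omega), h1]
    · rw [h _ (by omega) (by omega), h2]
    · rw [h _ (by omega) (by omega), h3]

theorem stored_append {m : ℕ → ℕ} : ∀ {p : ℕ} {l l' : List (ℕ × ℕ × ℕ)}, Stored m p l →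
    Stored m (p + 3 * l.length) l' → Stored m p (l ++ l')
  | _, [], _, _, h => h
  | p, e :: l, l', ⟨h1, h2, h3, h4⟩, h => by
    refine ⟨h1, h2, h3, stored_append h4 ?_⟩
    convert h using 1
    simp only [List.length_cons]; ring

/-- The registers from `b` on have kept their contents, except for the labels of the `n`
vertices. -/
def Kept (b n : ℕ) (s s' : State) : Prop :=
  ∀ r, b ≤ r → r < 32 ∨ 32 + n ≤ r → s'.mem r = s.mem r

theorem Kept.refl (b n : ℕ) (s : State) : Kept b n s s := fun _ _ _ => rfl

theorem Kept.trans {b n : ℕ} {s s' s'' : State} (h : Kept b n s s') (h' : Kept b n s' s'') :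
    Kept b n s s'' := fun r h1 h2 => (h' r h1 h2).trans (h r h1 h2)

theorem Kept.mono {b b' n : ℕ} {s s' : State} (h : Kept b n s s') (hb : b ≤ b') :
    Kept b' n s s' := fun r h1 h2 => h r (hb.trans h1) h2

/-- The constants and the directed edges are stored in their places. -/
structure Ready (n d : ℕ) (E : List (ℕ × ℕ × ℕ)) (s : State) : Prop where
  vertices : s.mem 16 = n
  edges : s.mem 17 = E.length
  modulus : s.mem 18 = d
  pred : s.mem 19 = d - 1
  one : s.mem 20 = 1
  labels : s.mem 21 = 32
  list : s.mem 22 = 32 + n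
  stored : Stored s.mem (32 + n) E

/-- Registers below `16` are for work (`7` the discrepancy, `15` the label to try), `16` to `22`
hold constants, `23` to `26` serve search and enumeration. Vertex labels start at `32`, edges at `32
+ n`; the ends of an edge are stored as addresses of their labels. -/
theorem Ready.kept {b n d : ℕ} {E : List (ℕ × ℕ × ℕ)} {s s' : State} (h : Ready n d E s)
    (h' : Kept b n s s') (hb : b ≤ 16) : Ready n d E s' := by
  refine ⟨?_, ?_, ?_, ?_, ?_, ?_, ?_, h.stored.congr fun r hr _ => h' r (by omega) (by omega)⟩
  all_goals rw [h' _ (by omega) (by omega)]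
  exacts [h.vertices, h.edges, h.modulus, h.pred, h.one, h.labels, h.list]

/-- The labels and the discrepancy in the registers. -/
def Holds (n : ℕ) (σ : (ℕ → ℕ) × ℕ) (s : State) : Prop :=
  (∀ v < n, s.mem (32 + v) = σ.1 v) ∧ s.mem 7 = σ.2

/-- Fetch the edge at the address `mem 8`, and the labels of its ends. -/
def fetchProg : Program := .block (.load 1 8)
  [.add 8 8 20, .load 2 8, .add 8 8 20, .load 3 8, .add 8 8 20, .load 4 1, .load 5 2]

/-- The program for `Propagate.step`, after `fetchProg`. -/
def updateProg : Program := .when 4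
  (.seq (.block (.add 3 3 18) [.add 3 3 20, .sub 3 3 4])
    (.seq (.reduce 3)
      (.seq (.instr (.add 3 3 20))
        (.ite 5
          (.seq (.block (.add 3 3 18) [.sub 3 3 5])
            (.seq (.reduce 3) (.when 3 (.move 7 3))))
          (.instr (.store 2 3))))))

def stepProg : Program := .seq fetchProg updateProg

theorem wp_fetch {n d : ℕ} {E l : List (ℕ × ℕ × ℕ)} {e : ℕ × ℕ × ℕ} {σ : (ℕ → ℕ) × ℕ}
    {s : State} {Q : State → Prop} (hs : Ready n d E s) (hσ : Holds n σ s)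
    (hl : Stored s.mem (s.mem 8) (e :: l)) (hp : 32 + n ≤ s.mem 8) (h1 : e.1 < n) (h2 : e.2.1 < n)
    (h : ∀ s', Kept 9 n s s' → Holds n σ s' → s'.out = s.out → s'.mem 2 = 32 + e.2.1 →
      s'.mem 3 = e.2.2 → s'.mem 4 = σ.1 e.1 → s'.mem 5 = σ.1 e.2.1 → s'.mem 8 = s.mem 8 + 3 →
      Q s') : WP fetchProg s 8 Q := by
  obtain ⟨m, inp, out⟩ := s
  refine WP.block (h _ ?_ ?_ rfl ?_ ?_ ?_ ?_ ?_)
  all_goals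
    obtain ⟨ha, hb, hc, -⟩ := hl
    have h20 := hs.one
    have hu := hσ.1 _ h1
    have hv := hσ.1 _ h2
    obtain ⟨p, hp8⟩ : ∃ p, m 8 = p := ⟨_, rfl⟩
    simp only [hp8] at h20 ha hb hc hu hv hp
    simp (disch := omega) only [List.foldl, Instr.apply, Function.update_self,
      Function.update_of_ne, h20, ha, hb, hc, hu, hv, hp8, add_assoc, Nat.reduceAdd]
  · intro r hr _
    simp (disch := omega) only [Function.update_of_ne]
  · refine ⟨fun v hv => ?_, ?_⟩
    · have := hσ.1 v hv
      simp (disch := omega) only [Function.update_of_ne]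
      exact this
    · have := hσ.2
      simp (disch := omega) only [Function.update_of_ne]
      exact this

theorem wp_update {n d : ℕ} {E : List (ℕ × ℕ × ℕ)} {e : ℕ × ℕ × ℕ} {σ : (ℕ → ℕ) × ℕ}
    {s : State} {Q : State → Prop} (hs : Ready n d E s) (hσ : Holds n σ s)
    (h2 : e.2.1 < n) (hr2 : s.mem 2 = 32 + e.2.1) (hr3 : s.mem 3 = e.2.2)
    (hr4 : s.mem 4 = σ.1 e.1) (hr5 : s.mem 5 = σ.1 e.2.1)
    (h : ∀ s', Kept 8 n s s' → Holds n (step d σ e) s' → s'.out = s.out → Q s') :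
    WP updateProg s 21 Q := by
  obtain ⟨m, inp, out⟩ := s
  have h18 := hs.modulus
  have h19 := hs.pred
  have h20 := hs.one
  have hlab := hσ.1
  have h7 := hσ.2
  simp only at h18 h19 h20 hr2 hr3 hr4 hr5 hlab h7
  refine WP.when (k := 19) (fun h4 => ?_) fun h4 => ?_
  · simp only [hr4] at h4
    refine WP.seq (k := 3) (k' := 16) (WP.block ?_)
    simp (disch := omega) only [List.foldl, Instr.apply, Function.update_self,
      Function.update_of_ne, h18, h20, hr3, hr4]
    refine WP.seq (k := 4) (k' := 12) (WP.reduce (by decide) ?_)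
    simp (disch := omega) only [Function.update_self, Function.update_of_ne, h18, h19]
    rw [← red]
    refine WP.seq (k := 1) (k' := 11) (WP.instr ?_)
    simp (disch := omega) only [Instr.apply, Function.update_self, Function.update_of_ne, h20]
    refine WP.ite (k := 10) (fun h5 => ?_) fun h5 => ?_
    · refine WP.seq (k := 2) (k' := 8) (WP.block ?_)
      simp (disch := omega) only [List.foldl, Instr.apply, Function.update_self,
        Function.update_of_ne, h18, hr5] at h5 ⊢
      refine WP.seq (k := 4) (k' := 4) (WP.reduce (by decide) ?_)
      simp (disch := omega) only [Function.update_self, Function.update_of_ne, h18, h19]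
      rw [← red]
      refine WP.when (k := 2) (fun h3 => WP.move (by decide) ?_) fun h3 => ?_
      · simp only [Function.update_self] at h3 ⊢
        refine h _ ?_ ?_ rfl
        · intro r hr _
          simp (disch := omega) only [Function.update_of_ne]
        · simp only [step, h4, h5, if_false, h3]
          refine ⟨fun v hv => ?_, ?_⟩
          · simp (disch := omega) only [Function.update_of_ne]
            exact hlab v hv
          · simp only [Function.update_self]
      · simp only [Function.update_self] at h3
        refine h _ ?_ ?_ rfl
        · intro r hr _
          simp (disch := omega) only [Function.update_of_ne]
        · simp only [step, h4, h5, if_false, h3, if_true]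
          refine ⟨fun v hv => ?_, ?_⟩
          · simp (disch := omega) only [Function.update_of_ne]
            exact hlab v hv
          · simp (disch := omega) only [Function.update_of_ne]
            exact h7
    -- The far end `v` is unlabeled; register `2` holds its address `32 + v`, so the store labels
    -- it.
    · refine (WP.instr ?_).mono (k' := 10) (by norm_num) fun _ h => h
      simp (disch := omega) only [Instr.apply, Function.update_self,
        Function.update_of_ne, hr2, hr5] at h5 ⊢
      refine h _ ?_ ?_ rfl
      · intro r hr _
        simp (disch := omega) only [Function.update_of_ne]
      · simp only [step, h4, h5, if_false, if_true]
        refine ⟨fun v hv => ?_, ?_⟩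
        · by_cases hve : v = e.2.1
          · subst hve
            simp only [Function.update_self]
          · simp (disch := omega) only [Function.update_of_ne]
            exact hlab v hv
        · simp (disch := omega) only [Function.update_of_ne]
          exact h7
  · simp only [hr4] at h4
    refine h _ (Kept.refl _ _ _) ?_ rfl
    simpa only [step, h4, if_true] using hσ

theorem wp_step {n d : ℕ} {E l : List (ℕ × ℕ × ℕ)} {e : ℕ × ℕ × ℕ} {σ : (ℕ → ℕ) × ℕ}
    {s : State} {Q : State → Prop} (hs : Ready n d E s) (hσ : Holds n σ s)
    (hl : Stored s.mem (s.mem 8) (e :: l)) (hp : 32 + n ≤ s.mem 8) (h1 : e.1 < n) (h2 : e.2.1 < n)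
    (h : ∀ s', Kept 9 n s s' → Holds n (step d σ e) s' → s'.out = s.out →
      s'.mem 8 = s.mem 8 + 3 → Q s') : WP stepProg s 29 Q := by
  refine WP.seq (k := 8) (k' := 21) (wp_fetch hs hσ hl hp h1 h2 ?_)
  intro s₁ hk₁ hσ₁ ho₁ hr2 hr3 hr4 hr5 hr8
  refine wp_update (hs.kept hk₁ (by norm_num)) hσ₁ h2 hr2 hr3 hr4 hr5 ?_
  intro s₂ hk₂ hσ₂ ho₂
  exact h s₂ (hk₁.trans (hk₂.mono (by norm_num))) hσ₂ (ho₂.trans ho₁)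
    ((hk₂ 8 (by norm_num) (by norm_num)).trans hr8)

/-- The program for `Propagate.pass`. -/
def passProg : Program :=
  .seq (.move 8 22) (.seq (.move 9 17) (.loop 9 (.seq stepProg (.instr (.sub 9 9 20)))))

theorem wp_pass {n d : ℕ} {E : List (ℕ × ℕ × ℕ)} {σ : (ℕ → ℕ) × ℕ} {s : State}
    {Q : State → Prop} (hE : ∀ e ∈ E, e.1 < n ∧ e.2.1 < n) (hs : Ready n d E s)
    (hσ : Holds n σ s)
    (h : ∀ s', Kept 10 n s s' → Holds n (pass d E σ) s' → s'.out = s.out → Q s') :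
    WP passProg s (E.length * 31 + 5) Q := by
  obtain ⟨m, inp, out⟩ := s
  have h17 := hs.edges
  have h22 := hs.list
  simp only at h17 h22
  refine (WP.seq (k := 2) (WP.move (by decide) (WP.seq (k := 2)
    (k' := E.length * (30 + 1) + 1) (WP.move (by decide) ?_)))).mono (by omega) fun _ h => h
  simp (disch := omega) only [Function.update_of_ne, h17, h22]
  -- With `l` still to be treated, finishing the pass from the current `σ'` gives the result of the
  -- whole pass.
  refine (WP.loop_list (k := 30) (fun l s' => Kept 10 n ⟨m, inp, out⟩ s' ∧ s'.out = out ∧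
    s'.mem 9 = l.length ∧ Stored s'.mem (s'.mem 8) l ∧ 32 + n ≤ s'.mem 8 ∧
    (∀ e ∈ l, e.1 < n ∧ e.2.1 < n) ∧
    ∃ σ', Holds n σ' s' ∧ pass d l σ' = pass d E σ) ?_ ?_ E _ ?_).mono le_rfl ?_
  · rintro e l s' ⟨hk, ho, h9, hl, h8, hb, σ', hσ', hp⟩
    refine ⟨by rw [h9]; simp, ?_⟩
    refine WP.seq (k := 29) (k' := 1) (wp_step (hs.kept hk (by norm_num)) hσ' hl h8
      (hb e (by simp)).1 (hb e (by simp)).2 ?_)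
    rintro ⟨m₁, inp₁, out₁⟩ hk₁ hσ₁ ho₁ hr8
    have h20 := ((hs.kept hk (by norm_num)).kept hk₁ (by norm_num)).one
    have h9' := hk₁ 9 (by norm_num) (by norm_num)
    rw [h9, List.length_cons] at h9'
    simp only at h20 ho₁ hr8 h9'
    refine WP.instr ⟨?_, ho₁.trans ho, ?_, ?_, ?_, fun e' he' => hb e' (by simp [he']),
      step d σ' e, ⟨fun v hv => ?_, ?_⟩, hp⟩
    · refine hk.trans ((hk₁.mono (by norm_num)).trans fun r hr _ => ?_)
      simp (disch := omega) only [Instr.apply, Function.update_of_ne]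
    · simp only [Instr.apply, Function.update_self, h20, h9']
      omega
    · simp (disch := omega) only [Instr.apply, Function.update_of_ne, hr8]
      refine hl.2.2.2.congr fun r hr _ => ?_
      simp (disch := omega) only [Function.update_of_ne]
      exact hk₁ r (by omega) (by omega)
    · simp (disch := omega) only [Instr.apply, Function.update_of_ne, hr8]
      omega
    · simp (disch := omega) only [Instr.apply, Function.update_of_ne]
      exact hσ₁.1 v hv
    · simp (disch := omega) only [Instr.apply, Function.update_of_ne]
      exact hσ₁.2
  · rintro s' ⟨-, -, h9, -⟩
    exact h9
  · refine ⟨fun r hr _ => ?_, rfl, ?_, ?_, ?_, hE, σ, ⟨fun v hv => ?_, ?_⟩, rfl⟩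
    · simp (disch := omega) only [Function.update_of_ne]
    · simp only [Function.update_self]
    · simp (disch := omega) only [Function.update_of_ne, Function.update_self]
      refine hs.stored.congr fun r hr _ => ?_
      simp (disch := omega) only [Function.update_of_ne]
    · simp (disch := omega) only [Function.update_of_ne, Function.update_self]
      exact le_rfl
    · simp (disch := omega) only [Function.update_of_ne]
      exact hσ.1 v hv
    · simp (disch := omega) only [Function.update_of_ne]
      exact hσ.2
  · rintro s' ⟨hk, ho, -, -, -, -, σ', hσ', hp⟩
    refine h s' hk ?_ ho
    rw [← hp]
    exact hσ'

/-- Label the vertex `0` by `mem 15`, and forget all other labels. -/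
def startProg : Program :=
  .seq (.reduce 15) (.seq (.block (.const 7 0) [.const 3 0])
    (.seq (.move 8 21) (.seq (.move 9 16)
      (.seq (.loop 9 (.block (.store 8 3) [.add 8 8 20, .sub 9 9 20]))
        (.block (.add 3 15 20) [.store 21 3])))))

theorem wp_start {n d : ℕ} {E : List (ℕ × ℕ × ℕ)} {s : State} {Q : State → Prop} (hn : 0 < n)
    (hs : Ready n d E s)
    (h : ∀ s', Kept 16 n s s' → Holds n (start d (s.mem 15)) s' → s'.out = s.out →
      s'.mem 15 = red d (s.mem 15) → Q s') :
    WP startProg s (n * 4 + 13) Q := by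
  obtain ⟨m, inp, out⟩ := s
  have h16 := hs.vertices
  have h18 := hs.modulus
  have h19 := hs.pred
  have h20 := hs.one
  have h21 := hs.labels
  simp only at h16 h18 h19 h20 h21
  refine (WP.seq (k := 4) (WP.reduce (by decide) (WP.seq (k := 2) (WP.block
    (WP.seq (k := 2) (WP.move (by decide) (WP.seq (k := 2) (WP.move (by decide)
    (WP.seq (k := n * (3 + 1) + 1) (k' := 2) ?_))))))))).mono (by omega) fun _ h => h
  simp (disch := omega) only [Instr.apply, Function.update_of_ne, h16, h18, h19, h21]
  rw [← red]
  obtain ⟨x, hx⟩ : ∃ x, m 15 = x := ⟨_, rfl⟩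
  simp only [hx] at h ⊢
  -- The first `n - j` labels are cleared; vertex `0` receives its label after the loop.
  refine (WP.loop_count (k := 3) (fun j s' => j ≤ n ∧ s'.out = out ∧ s'.mem 9 = j ∧
    s'.mem 8 = 32 + (n - j) ∧ s'.mem 3 = 0 ∧ s'.mem 7 = 0 ∧ s'.mem 15 = red d x ∧
    (∀ v < n - j, s'.mem (32 + v) = 0) ∧ Kept 16 n ⟨m, inp, out⟩ s') ?_ ?_ n _ ?_).mono le_rfl ?_
  · rintro j ⟨m', inp', out'⟩ ⟨hj, ho, h9, h8, h3, h7, h15, hl, hk⟩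
    have h20' := (hs.kept hk le_rfl).one
    simp only at ho h9 h8 h3 h7 h15 hl h20'
    refine ⟨by simp only [h9]; omega, WP.block ?_⟩
    simp (disch := omega) only [List.foldl, Instr.apply, Function.update_self,
      Function.update_of_ne, h8, h9, h20', h3]
    refine ⟨by omega, ho, rfl, by omega, trivial, h7, h15, fun v hv => ?_, fun r hr hr' => ?_⟩
    · by_cases hve : v = n - (j + 1)
      · subst hve
        simp only [Function.update_self]
      · simp (disch := omega) only [Function.update_of_ne]
        exact hl v (by omega)
    · simp (disch := omega) only [Function.update_of_ne]
      exact hk r hr hr'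
  · rintro s' ⟨-, -, h9, -⟩
    exact h9
  · refine ⟨le_rfl, rfl, ?_, ?_, ?_, ?_, ?_, fun v hv => by omega, fun r hr _ => ?_⟩
    all_goals simp (disch := omega) only [Function.update_of_ne, Function.update_self]
    omega
  · rintro ⟨m', inp', out'⟩ ⟨-, ho, -, -, h3, h7, h15, hl, hk⟩
    have h20' := (hs.kept hk le_rfl).one
    have h21' := (hs.kept hk le_rfl).labels
    simp only at ho h3 h7 h15 hl h20' h21'
    refine WP.block ?_
    simp (disch := omega) only [List.foldl, Instr.apply, Function.update_self,
      Function.update_of_ne, h15, h20', h21']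
    refine h _ (hk.trans fun r hr hr' => ?_) ⟨fun v hv => ?_, ?_⟩ ho ?_
    · simp (disch := omega) only [Function.update_of_ne]
    · by_cases hv0 : v = 0
      · subst hv0
        simp only [add_zero, Function.update_self, start, if_true]
      · simp (disch := omega) only [Function.update_of_ne, start, hv0, if_false]
        exact hl v (by omega)
    · simp (disch := omega) only [Function.update_of_ne, start]
      exact h7
    · simp (disch := omega) only [Function.update_of_ne]
      exact h15

/-- The program for `Propagate.check`, applied to `mem 15`. -/
def checkProg : Program :=
  .seq startProg (.seq (.move 10 16) (.loop 10 (.seq passProg (.instr (.sub 10 10 20)))))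

/-- A bound for the number of steps of `checkProg`. -/
def checkCost (n l : ℕ) : ℕ := n * 4 + 13 + (2 + (n * (l * 31 + 7) + 1))

theorem wp_check {n d : ℕ} {E : List (ℕ × ℕ × ℕ)} {s : State} {Q : State → Prop} (hn : 0 < n)
    (hE : ∀ e ∈ E, e.1 < n ∧ e.2.1 < n) (hs : Ready n d E s)
    (h : ∀ s', Kept 16 n s s' → Holds n (check n d E (s.mem 15)) s' → s'.out = s.out →
      s'.mem 15 = red d (s.mem 15) → Q s') :
    WP checkProg s (checkCost n E.length) Q := by
  refine WP.seq (wp_start hn hs ?_)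
  intro s₁ hk₁ hσ₁ ho₁ h15
  obtain ⟨m, inp, out⟩ := s₁
  have h16 := (hs.kept hk₁ le_rfl).vertices
  simp only at h16 h15 ho₁
  refine WP.seq (k := 2) (WP.move (by decide) ?_)
  rw [h16]
  refine (WP.loop_count (k := E.length * 31 + 6) (fun j s' => j ≤ n ∧ s'.out = s.out ∧
    s'.mem 10 = j ∧ s'.mem 15 = red d (s.mem 15) ∧ Kept 16 n s s' ∧
    Holds n ((pass d E)^[n - j] (start d (s.mem 15))) s') ?_ ?_ n _ ?_).mono le_rfl ?_
  · rintro j s' ⟨hj, ho, h10, h15', hk, hσ⟩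
    refine ⟨by rw [h10]; omega, ?_⟩
    refine WP.seq (k := E.length * 31 + 5) (k' := 1) (wp_pass hE (hs.kept hk le_rfl) hσ ?_)
    rintro ⟨m₂, inp₂, out₂⟩ hk₂ hσ₂ ho₂
    have h20 := ((hs.kept hk le_rfl).kept hk₂ (by norm_num)).one
    have h10' := hk₂ 10 (by norm_num) (by norm_num)
    have h15'' := hk₂ 15 (by norm_num) (by norm_num)
    rw [h10] at h10'
    rw [h15'] at h15''
    simp only at h20 h10' h15'' ho₂
    refine WP.instr ⟨by omega, ho₂.trans ho, ?_, ?_, ?_, ?_⟩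
    · simp only [Instr.apply, Function.update_self, h20, h10']
      omega
    · simp (disch := omega) only [Instr.apply, Function.update_of_ne]
      exact h15''
    · refine hk.trans ((hk₂.mono (by norm_num)).trans fun r hr _ => ?_)
      simp (disch := omega) only [Instr.apply, Function.update_of_ne]
    · rw [show n - j = n - (j + 1) + 1 by omega, Function.iterate_succ_apply']
      refine ⟨fun v hv => ?_, ?_⟩
      · simp (disch := omega) only [Instr.apply, Function.update_of_ne]
        exact hσ₂.1 v hv
      · simp (disch := omega) only [Instr.apply, Function.update_of_ne]
        exact hσ₂.2
  · rintro s' ⟨-, -, h10, -⟩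
    exact h10
  · refine ⟨le_rfl, ho₁, ?_, ?_, hk₁.trans fun r hr _ => ?_, ?_⟩
    · simp only [Function.update_self]
    · simp (disch := omega) only [Function.update_of_ne]
      exact h15
    · simp (disch := omega) only [Function.update_of_ne]
    · rw [Nat.sub_self]
      refine ⟨fun v hv => ?_, ?_⟩
      · simp (disch := omega) only [Function.update_of_ne]
        exact hσ₁.1 v hv
      · simp (disch := omega) only [Function.update_of_ne]
        exact hσ₁.2
  · rintro s' ⟨-, ho, -, h15', hk, hσ⟩
    exact h s' hk hσ ho h15'

/-- Write the labels of all vertices. -/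
def printProg : Program :=
  .seq (.move 8 21) (.seq (.move 9 16)
    (.loop 9 (.block (.load 3 8) [.sub 3 3 20, .write 3, .add 8 8 20, .sub 9 9 20])))

theorem wp_print {n d : ℕ} {E : List (ℕ × ℕ × ℕ)} {σ : (ℕ → ℕ) × ℕ} {s : State}
    {Q : State → Prop} (hs : Ready n d E s) (hσ : Holds n σ s)
    (h : ∀ s', Kept 16 n s s' → s'.out = s.out ++ (List.range n).map (fun v => σ.1 v - 1) →
      Q s') :
    WP printProg s (n * 6 + 5) Q := by
  obtain ⟨m, inp, out⟩ := s
  have h16 := hs.vertices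
  have h21 := hs.labels
  simp only at h16 h21
  refine (WP.seq (k := 2) (WP.move (by decide) (WP.seq (k := 2) (k' := n * (5 + 1) + 1)
    (WP.move (by decide) ?_)))).mono (by omega) fun _ h => h
  simp (disch := omega) only [Function.update_of_ne, h16, h21]
  refine (WP.loop_count (k := 5) (fun j s' => j ≤ n ∧ s'.mem 9 = j ∧ s'.mem 8 = 32 + (n - j) ∧
    (∀ r, 10 ≤ r → s'.mem r = m r) ∧
    s'.out = out ++ (List.range (n - j)).map (fun v => σ.1 v - 1)) ?_ ?_ n _ ?_).mono le_rfl ?_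
  · rintro j ⟨m', inp', out'⟩ ⟨hj, h9, h8, hk, ho⟩
    have h20 := hk 20 (by norm_num)
    rw [show m 20 = 1 from hs.one] at h20
    have hlab := hk (32 + (n - (j + 1))) (by omega)
    rw [show m (32 + (n - (j + 1))) = _ from hσ.1 _ (by omega)] at hlab
    simp only at h9 h8 ho h20 hlab
    refine ⟨by simp only [h9]; omega, WP.block ?_⟩
    simp (disch := omega) only [List.foldl, Instr.apply, Function.update_self,
      Function.update_of_ne, h8, h9, h20, hlab]
    refine ⟨by omega, rfl, by omega, fun r hr => ?_, ?_⟩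
    · simp (disch := omega) only [Function.update_of_ne]
      exact hk r hr
    · rw [ho, show n - j = n - (j + 1) + 1 by omega, List.range_succ]
      simp
  · rintro s' ⟨-, h9, -⟩
    exact h9
  · refine ⟨le_rfl, ?_, ?_, fun r hr => ?_, by simp⟩
    all_goals simp (disch := omega) only [Function.update_of_ne, Function.update_self]
    omega
  · rintro s' ⟨-, -, -, hk, ho⟩
    exact h s' (fun r hr _ => hk r (by omega)) (by simpa using ho)

/-- Read the input and prepare the registers. -/
def readProg : Program :=
  .seq (.block (.read 16) [.read 17, .read 18, .const 20 1, .sub 19 18 20, .const 21 32,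
      .add 22 21 16, .add 8 22 0, .add 9 17 0])
    (.seq (.loop 9 (.block (.read 1) [.read 2, .read 3, .add 1 1 21, .add 2 2 21,
      .store 8 1, .add 8 8 20, .store 8 2, .add 8 8 20, .store 8 3, .add 8 8 20,
      .store 8 2, .add 8 8 20, .store 8 1, .add 8 8 20, .store 8 3, .add 8 8 20, .sub 9 9 20]))
    (.instr (.add 17 17 17)))

theorem wp_read {n d : ℕ} (L : List (Fin n × Fin n × ZMod d)) {Q : State → Prop}
    (h : ∀ s, Ready n d (directedEdges L) s → s.out = [] → s.mem 24 = 0 → Q s) :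
    WP readProg ⟨fun _ => 0, inputOf L, []⟩ (L.length * 19 + 11) Q := by
  refine (WP.seq (k := 9) (WP.block (WP.seq (k := L.length * (18 + 1) + 1) (k' := 1)
    ?_))).mono (by omega) fun _ h => h
  simp (disch := omega) only [List.foldl, Instr.apply, Function.update_self,
    Function.update_of_ne, inputOf, List.headD_cons, List.tail_cons, add_zero]
  -- `E` is the part already stored, in both orientations. Register `17` still counts undirected
  -- edges and is doubled at the end.
  refine (WP.loop_list (k := 18) (fun l s' => s'.out = [] ∧
    s'.inp = l.flatMap (fun x => [x.1.val, x.2.1.val, x.2.2.val]) ∧ s'.mem 9 = l.length ∧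
    s'.mem 16 = n ∧ s'.mem 17 = L.length ∧ s'.mem 18 = d ∧ s'.mem 19 = d - 1 ∧ s'.mem 20 = 1 ∧
    s'.mem 21 = 32 ∧ s'.mem 22 = 32 + n ∧ s'.mem 24 = 0 ∧
    ∃ E, E ++ directedEdges l = directedEdges L ∧ s'.mem 8 = 32 + n + 3 * E.length ∧
      Stored s'.mem (32 + n) E) ?_ ?_ L _ ?_).mono le_rfl ?_
  · rintro ⟨u, v, c⟩ l ⟨m, inp, out⟩
      ⟨ho, hi, h9, h16, h17, h18, h19, h20, h21, h22, h24, E, hE, h8, hst⟩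
    simp only [List.flatMap_cons, List.cons_append, List.nil_append] at ho hi
    simp only [List.length_cons] at h9 h16 h17 h18 h19 h20 h21 h22 h24 h8 hst
    subst hi
    refine ⟨by simp only [h9]; omega, WP.block ?_⟩
    obtain ⟨p, hp⟩ : ∃ p, 32 + n + 3 * E.length = p := ⟨_, rfl⟩
    rw [hp] at h8
    simp (disch := omega) only [List.foldl, Instr.apply, Function.update_self,
      Function.update_of_ne, h8, h9, h20, h21, List.headD_cons, List.tail_cons,
      add_assoc, Nat.reduceAdd]
    refine ⟨ho, trivial, rfl, h16, h17, h18, h19, trivial, trivial, h22, h24,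
      E ++ [(u.val, v.val, c.val), (v.val, u.val, c.val)], ?_, ?_, ?_⟩
    · rw [← hE]
      simp [directedEdges]
    · simp only [List.length_append, List.length_cons, List.length_nil]
      omega
    · refine stored_append (hst.congr fun r hr hr' => ?_) ?_
      · simp (disch := omega) only [Function.update_of_ne]
      · rw [hp]
        simp (disch := omega) only [Stored, Function.update_self, Function.update_of_ne, and_true, true_and,
          add_assoc, Nat.reduceAdd]
        omega
  · rintro s' ⟨-, -, h9, -⟩
    exact h9
  · refine ⟨rfl, rfl, ?_, ?_, ?_, ?_, ?_, ?_, ?_, ?_, ?_, [], rfl, ?_, trivial⟩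
    all_goals simp (disch := omega) only [Function.update_self, Function.update_of_ne,
      List.length_nil, mul_zero, add_zero]
  · rintro ⟨m, inp, out⟩
      ⟨ho, -, -, h16, h17, h18, h19, h20, h21, h22, h24, E, hE, h8, hst⟩
    simp only at ho h16 h17 h18 h19 h20 h21 h22 h24 h8 hst
    rw [directedEdges, List.flatMap_nil, List.append_nil] at hE
    subst hE
    refine WP.instr (h _ ⟨?_, ?_, ?_, ?_, ?_, ?_, ?_, ?_⟩ ho ?_)
    · simp (disch := omega) only [Instr.apply, Function.update_of_ne, h16]
    · simp only [Instr.apply, Function.update_self, h17]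
      simp [directedEdges, mul_two]
    · simp (disch := omega) only [Instr.apply, Function.update_of_ne, h18]
    · simp (disch := omega) only [Instr.apply, Function.update_of_ne, h19]
    · simp (disch := omega) only [Instr.apply, Function.update_of_ne, h20]
    · simp (disch := omega) only [Instr.apply, Function.update_of_ne, h21]
    · simp (disch := omega) only [Instr.apply, Function.update_of_ne, h22]
    · refine hst.congr fun r hr hr' => ?_
      simp (disch := omega) only [Instr.apply, Function.update_of_ne]
    · simp (disch := omega) only [Instr.apply, Function.update_of_ne, h24]

end RAM

/-! ## Search and enumeration -/

namespace RAM

open Propagate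

/-- If `check` accepts `mem 15`, then remember it in `mem 25`, and that this happened in
`mem 24`. -/
def tryProg : Program :=
  .seq checkProg (.ite 7 (.instr (.const 0 0)) (.seq (.instr (.const 24 1)) (.move 25 15)))

/-- Either `mem 25` is accepted by `check`, or no element of `l` is. -/
def Tried (n d : ℕ) (E : List (ℕ × ℕ × ℕ)) (l : List ℕ) (s : State) : Prop :=
  (s.mem 24 = 1 ∧ s.mem 25 < d ∧ (check n d E (s.mem 25)).2 = 0) ∨
    (s.mem 24 = 0 ∧ ∀ x ∈ l, (check n d E x).2 ≠ 0)

section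

variable {n d : ℕ} {E : List (ℕ × ℕ × ℕ)} {s : State} {Q : State → Prop}

theorem wp_try {l : List ℕ} (hn : 0 < n) (hE : ∀ e ∈ E, e.1 < n ∧ e.2.1 < n)
    (hs : Ready n d E s) (hx : s.mem 15 < 2 * d) (ht : Tried n d E l s)
    (h : ∀ s', Ready n d E s' → s'.out = s.out → s'.mem 23 = s.mem 23 →
      Tried n d E (l ++ [s.mem 15]) s' → Q s') :
    WP tryProg s (checkCost n E.length + 4) Q := by
  refine WP.seq (wp_check hn hE hs ?_)
  rintro ⟨m, inp, out⟩ hk hσ ho h15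
  have h23 := hk 23 (by norm_num) (by norm_num)
  have h24 := hk 24 (by norm_num) (by norm_num)
  have h25 := hk 25 (by norm_num) (by norm_num)
  have h7 := hσ.2
  simp only at h23 h24 h25 h7 h15 ho
  -- Nonzero register `7` means rejection. The instruction then executed touches only register `0`,
  -- so an earlier success is kept.
  refine WP.ite (k := 3) (fun hne => (WP.instr ?_).mono (by norm_num) fun _ h => h) fun hz =>
    WP.seq (k := 1) (k' := 2) (WP.instr (WP.move (by decide) ?_))
  · refine h _ ((hs.kept hk le_rfl).kept (b := 1) (fun r hr _ => ?_) (by norm_num)) ho ?_ ?_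
    · simp (disch := omega) only [Instr.apply, Function.update_of_ne]
    · simp (disch := omega) only [Instr.apply, Function.update_of_ne, h23]
    · simp only [h7] at hne
      simp (disch := omega) only [Tried, Instr.apply, Function.update_of_ne, h24, h25]
      refine ht.imp_right fun ⟨h1, h2⟩ => ⟨h1, fun x hx => ?_⟩
      rcases List.mem_append.1 hx with hx | hx
      · exact h2 x hx
      · rw [List.mem_singleton.1 hx]
        exact hne
  · refine h _ ⟨?_, ?_, ?_, ?_, ?_, ?_, ?_, (hs.kept hk le_rfl).stored.congr fun r hr _ => ?_⟩
      ho ?_ (Or.inl ⟨?_, ?_, ?_⟩)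
    all_goals simp (disch := omega) only [Function.update_of_ne, Function.update_self]
    · exact (hs.kept hk le_rfl).vertices
    · exact (hs.kept hk le_rfl).edges
    · exact (hs.kept hk le_rfl).modulus
    · exact (hs.kept hk le_rfl).pred
    · exact (hs.kept hk le_rfl).one
    · exact (hs.kept hk le_rfl).labels
    · exact (hs.kept hk le_rfl).list
    · exact h23
    · rw [h15]
      exact red_lt hx
    · rw [h15, check_red hx, ← h7]
      exact hz

/-- Compute `mem 15` by `P`, and try it. -/
theorem wp_seq_try {P : Program} {k x : ℕ} {l : List ℕ} (hn : 0 < n)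
    (hE : ∀ e ∈ E, e.1 < n ∧ e.2.1 < n) (hs : Ready n d E s) (ht : Tried n d E l s)
    (hP : WP P s k fun s' => s'.out = s.out ∧ s'.mem 15 = x ∧ ∀ r, 16 ≤ r → s'.mem r = s.mem r)
    (hx : x < 2 * d)
    (h : ∀ s', Ready n d E s' → s'.out = s.out → s'.mem 23 = s.mem 23 →
      Tried n d E (l ++ [x]) s' → Q s') :
    WP (.seq P tryProg) s (k + (checkCost n E.length + 4)) Q := by
  refine WP.seq (hP.mono le_rfl ?_)
  rintro s' ⟨ho, h15, hk⟩
  refine wp_try (l := l) hn hE (hs.kept (b := 16) (fun r hr _ => hk r hr) le_rfl) (h15 ▸ hx) ?_ ?_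
  · simpa only [Tried, hk 24 (by norm_num), hk 25 (by norm_num)] using ht
  · intro s'' h1 h2 h3 h4
    exact h s'' h1 (h2.trans ho) (h3.trans (hk 23 (by norm_num))) (h15 ▸ h4)

/-- Try all candidates, where `mem 23` is the discrepancy for the label `0`. -/
def candidatesProg : Program :=
  .seq (.seq (.instr (.half 15 23)) tryProg)
    (.seq (.seq (.block (.add 15 23 18) [.half 15 15]) tryProg)
      (.seq (.seq (.block (.sub 15 18 23) [.half 15 15]) tryProg)
        (.seq (.block (.add 15 18 18) [.sub 15 15 23, .half 15 15]) tryProg)))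

theorem wp_candidates (hn : 0 < n) (hE : ∀ e ∈ E, e.1 < n ∧ e.2.1 < n) (hs : Ready n d E s)
    (h23 : s.mem 23 < d) (h24 : s.mem 24 = 0)
    (h : ∀ s', Ready n d E s' → s'.out = s.out →
      Tried n d E (candidates d (s.mem 23)) s' → Q s') :
    WP candidatesProg s (checkCost n E.length * 4 + 24) Q := by
  have hlt := candidates_lt h23
  simp only [candidates, List.mem_cons, List.not_mem_nil, or_false, forall_eq_or_imp,
    forall_eq] at hlt
  obtain ⟨l1, l2, l3, l4⟩ := hlt
  generalize he : s.mem 23 = e at *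
  refine (WP.seq (k := 1 + (checkCost n E.length + 4)) (wp_seq_try (x := e / 2) (l := [])
    hn hE hs (Or.inr ⟨h24, by simp⟩) (WP.instr ⟨rfl, ?_, fun r hr => ?_⟩) l1
    fun s₁ hs₁ ho₁ h23₁ ht₁ =>
    WP.seq (k := 2 + (checkCost n E.length + 4)) (wp_seq_try (x := (e + d) / 2)
    hn hE hs₁ ht₁ (WP.block ⟨rfl, ?_, fun r hr => ?_⟩) l2 fun s₂ hs₂ ho₂ h23₂ ht₂ =>
    WP.seq (k := 2 + (checkCost n E.length + 4)) (k' := 3 + (checkCost n E.length + 4))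
    (wp_seq_try (x := (d - e) / 2)
    hn hE hs₂ ht₂ (WP.block ⟨rfl, ?_, fun r hr => ?_⟩) l3 fun s₃ hs₃ ho₃ h23₃ ht₃ =>
    wp_seq_try (x := (d + d - e) / 2)
    hn hE hs₃ ht₃ (WP.block ⟨rfl, ?_, fun r hr => ?_⟩) l4 fun s₄ hs₄ ho₄ h23₄ ht₄ =>
    h s₄ hs₄ (ho₄.trans (ho₃.trans (ho₂.trans ho₁))) ht₄)))).mono (by omega) fun _ h => h
  · simp only [Instr.apply, Function.update_self, he]
  · simp (disch := omega) only [Instr.apply, Function.update_of_ne]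
  · simp only [List.foldl, Instr.apply, Function.update_self, h23₁, he, hs₁.modulus]
  · simp (disch := omega) only [List.foldl, Instr.apply, Function.update_of_ne]
  · simp only [List.foldl, Instr.apply, Function.update_self, h23₂, h23₁, he, hs₂.modulus]
  · simp (disch := omega) only [List.foldl, Instr.apply, Function.update_of_ne]
  · simp (disch := omega) only [List.foldl, Instr.apply, Function.update_self,
      Function.update_of_ne, h23₃, h23₂, h23₁, he, hs₃.modulus]
  · simp (disch := omega) only [List.foldl, Instr.apply, Function.update_of_ne]

/-- What is written for the labels in `l` of the vertex `0`. -/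
def emitted (n d : ℕ) (E : List (ℕ × ℕ × ℕ)) (l : List ℕ) : List ℕ :=
  l.flatMap fun x => if (check n d E x).2 = 0 then
    (List.range n).map (fun v => (check n d E x).1 v - 1) else []

/-- If `check` accepts `mem 15`, then write the labeling. -/
def emitProg : Program := .seq checkProg (.ite 7 (.instr (.const 0 0)) printProg)

/-- A bound for the number of steps of `emitProg`. -/
def emitCost (n l : ℕ) : ℕ := checkCost n l + (n * 6 + 5 + 1)

theorem wp_emit (hn : 0 < n) (hE : ∀ e ∈ E, e.1 < n ∧ e.2.1 < n) (hs : Ready n d E s)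
    (h : ∀ s', Kept 16 n s s' → s'.out = s.out ++ emitted n d E [s.mem 15] → Q s') :
    WP emitProg s (emitCost n E.length) Q := by
  refine WP.seq (wp_check hn hE hs ?_)
  intro s₁ hk hσ ho _
  refine WP.ite (fun h7 => (WP.instr ?_).mono (by omega) fun _ h => h) fun h7 =>
    wp_print (hs.kept hk le_rfl) hσ ?_
  · rw [hσ.2] at h7
    refine h _ (hk.trans fun r hr _ => ?_) ?_
    · simp (disch := omega) only [Instr.apply, Function.update_of_ne]
    · simp [emitted, h7, Instr.apply, ho]
  · rw [hσ.2] at h7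
    intro s₂ hk₂ ho₂
    refine h s₂ (hk.trans hk₂) ?_
    rw [ho₂, ho]
    simp [emitted, h7]

/-- Write the labelings that arise from `mem 25`, a label of the vertex `0` that is accepted. -/
def enumerateProg : Program :=
  .seq (.instr (.add 15 25 20)) (.seq checkProg (.ite 7
    (.seq (.seq (.move 15 25) emitProg)
      (.seq (.block (.half 15 18) [.add 15 15 25]) emitProg))
    (.seq (.move 26 18)
      (.loop 26 (.seq (.instr (.sub 26 26 20)) (.seq (.move 15 26) emitProg))))))

/-- A bound for the number of steps of `enumerateProg`. -/
def enumerateCost (n l N : ℕ) : ℕ :=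
  1 + (checkCost n l + (2 * emitCost n l + 4 + N * (emitCost n l + 4) + 1))

/-- `N` pays only for the loop over all residues, which is entered just when `y + 1` is accepted;
`hN` then bounds its `d` rounds. -/
theorem wp_enumerate {N : ℕ} (hn : 0 < n) (hE : ∀ e ∈ E, e.1 < n ∧ e.2.1 < n)
    (hs : Ready n d E s) (hN : (check n d E (s.mem 25 + 1)).2 = 0 → d ≤ N)
    (h : ∀ s', s'.out = s.out ++ emitted n d E (starts n d E (s.mem 25)) → Q s') :
    WP enumerateProg s (enumerateCost n E.length N) Q := by
  generalize hy : s.mem 25 = y at *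
  have hk₀ : Kept 16 n s ((Instr.add 15 25 20).apply s) := fun r hr _ => by
    simp (disch := omega) only [Instr.apply, Function.update_of_ne]
  refine WP.seq (WP.instr (WP.seq (wp_check hn hE (hs.kept hk₀ le_rfl) ?_)))
  rintro ⟨m, inp, out⟩ hk hσ ho _
  have hs₁ := (hs.kept hk₀ le_rfl).kept hk le_rfl
  have h25 := (hk 25 (by norm_num) (by norm_num)).trans (hk₀ 25 (by norm_num) (by norm_num))
  have h7 := hσ.2
  have h18 := hs₁.modulus
  simp only [Instr.apply, Function.update_self, hy, hs.one] at h7 h25 ho h18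
  refine WP.ite (fun hne => ?_) fun hz => ?_
  · simp only [h7] at hne
    refine (WP.seq (k := 2 + emitCost n E.length) (k' := 2 + emitCost n E.length)
      (WP.seq (WP.move (by decide) (wp_emit hn hE (hs₁.kept (b := 16) (fun r hr _ => ?_) le_rfl)
      fun s₂ hk₂ ho₂ => WP.seq (WP.block (wp_emit hn hE (hs₁.kept (b := 16) (fun r hr hr' => ?_)
      le_rfl) fun s₃ hk₃ ho₃ => h s₃ ?_)))))).mono (by omega) fun _ h => h
    · simp (disch := omega) only [Function.update_of_ne]
    · simp (disch := omega) only [List.foldl, Instr.apply, Function.update_of_ne]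
      rw [hk₂ r hr hr']
      simp (disch := omega) only [Function.update_of_ne]
    · have h18₂ := hk₂ 18 (by norm_num) (by norm_num)
      have h25₂ := hk₂ 25 (by norm_num) (by norm_num)
      simp (disch := omega) only [Function.update_of_ne, h18, h25] at h18₂ h25₂
      rw [ho₃]
      simp (disch := omega) only [List.foldl, Instr.apply, Function.update_of_ne,
        Function.update_self, ho₂, ho, h18₂, h25₂, h25]
      rw [starts, if_neg hne, add_comm (d / 2)]
      simp [emitted]
  · simp only [h7] at hz
    refine (WP.seq (k := 2) (k' := d * (emitCost n E.length + 3 + 1) + 1)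
      (WP.move (by decide) ?_)).mono ?_ fun _ h => h
    · simp only [h18]
      -- Counting down explains the reversed range in `starts`. The output so far, followed by what
      -- the remaining labels will emit, stays constant.
      refine (WP.loop_count (k := emitCost n E.length + 3) (fun j s' => s'.mem 26 = j ∧
        Ready n d E s' ∧
        s'.out ++ emitted n d E (List.range j).reverse =
          s.out ++ emitted n d E (List.range d).reverse) ?_ ?_ d _ ?_).mono le_rfl ?_
      · rintro j ⟨m', inp', out'⟩ ⟨h26, hs', ho'⟩
        have h20 := hs'.one
        simp only at h26 h20 ho'
        refine ⟨by simp only [h26]; omega, ?_⟩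
        refine (WP.seq (k := 1) (k' := 2 + emitCost n E.length) (WP.instr (WP.seq
          (WP.move (by decide) ?_)))).mono (by omega) fun _ h => h
        simp only [Function.update_self, h26, h20, Nat.add_sub_cancel]
        have hs₁ : Ready n d E ⟨Function.update (Function.update (Function.update m' 26 j) 0 0) 15 j,
            inp', out'⟩ := by
          refine ⟨?_, ?_, ?_, ?_, ?_, ?_, ?_, hs'.stored.congr fun r hr _ => ?_⟩
          all_goals simp (disch := omega) only [Function.update_of_ne]
          · exact hs'.vertices
          · exact hs'.edges
          · exact hs'.modulus
          · exact hs'.pred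
          · exact hs'.one
          · exact hs'.labels
          · exact hs'.list
        refine wp_emit hn hE hs₁ fun s₂ hk₂ ho₂ => ⟨?_, hs₁.kept hk₂ le_rfl, ?_⟩
        · rw [hk₂ 26 (by norm_num) (by norm_num)]
          simp (disch := omega) only [Function.update_of_ne, Function.update_self]
        · rw [ho₂, ← ho', List.range_succ]
          simp [emitted]
      · rintro s' ⟨h26, -⟩
        exact h26
      · refine ⟨?_, ⟨?_, ?_, ?_, ?_, ?_, ?_, ?_, hs₁.stored.congr fun r hr _ => ?_⟩, ?_⟩
        all_goals simp (disch := omega) only [Function.update_of_ne, Function.update_self]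
        · exact hs₁.vertices
        · exact hs₁.edges
        · exact hs₁.modulus
        · exact hs₁.pred
        · exact hs₁.one
        · exact hs₁.labels
        · exact hs₁.list
        · rw [ho]
      · rintro s' ⟨-, -, ho'⟩
        refine h s' ?_
        rw [starts, if_pos hz, ← ho']
        simp [emitted]
    · have : d * (emitCost n E.length + 3 + 1) ≤ N * (emitCost n E.length + 4) :=
        Nat.mul_le_mul_right _ (hN hz)
      omega

end

/-! ### The two complete programs -/

/-- Read the input, and search for an accepted label of the vertex `0`. -/
def searchProg : Program :=
  .seq readProg (.seq (.instr (.const 15 0)) (.seq checkProg (.seq (.move 23 7) candidatesProg)))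

/-- Decide additivity. -/
def decideProg : Program := .seq searchProg (.instr (.write 24))

/-- List all labelings. -/
def listProg : Program := .seq searchProg (.when 24 enumerateProg)

section

variable {n d : ℕ} {G : SimpleGraph (Fin n)} {fE : G.edgeSet → ZMod d}
  {L : List (Fin n × Fin n × ZMod d)} {Q : State → Prop} (hd : 0 < d) (hn : 0 < n)
  (hG : G.Connected) (hL : ListsEdges G fE L)

theorem length_directedEdges : (directedEdges L).length = L.length * 2 := by
  simp [directedEdges]

theorem ends_lt : ∀ e ∈ directedEdges L, e.1 < n ∧ e.2.1 < n := by
  simp only [directedEdges, List.mem_flatMap, List.mem_cons, List.not_mem_nil, or_false]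
  rintro e ⟨x, -, rfl | rfl⟩ <;> simp

/-- A bound for the number of steps of `searchProg`. -/
def searchCost (n m : ℕ) : ℕ := m * 19 + 11 + (1 + (checkCost n (m * 2) +
  (2 + (checkCost n (m * 2) * 4 + 24))))

include hd hn hL in
theorem wp_search (h : ∀ s, Ready n d (directedEdges L) s → s.out = [] →
      Tried n d (directedEdges L) (candidates d (check n d (directedEdges L) 0).2) s → Q s) :
    WP searchProg ⟨fun _ => 0, inputOf L, []⟩ (searchCost n L.length) Q := by
  refine WP.seq (wp_read L fun s hs ho h24 => ?_)
  have hk₀ : Kept 16 n s ((Instr.const 15 0).apply s) := fun r hr _ => by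
    simp (disch := omega) only [Instr.apply, Function.update_of_ne]
  rw [← length_directedEdges]
  refine WP.seq (WP.instr (WP.seq (wp_check hn ends_lt (hs.kept hk₀ le_rfl) ?_)))
  rintro ⟨m, inp, out⟩ hk hσ ho₁ _
  have hs₁ := (hs.kept hk₀ le_rfl).kept hk le_rfl
  have h24₁ := (hk 24 (by norm_num) (by norm_num)).trans (hk₀ 24 (by norm_num) (by norm_num))
  have h7 := hσ.2
  simp only [Instr.apply, Function.update_self, h24, ho] at h7 h24₁ ho₁
  have hlt : (check n d (directedEdges L) 0).2 < d :=
    (small_iterate (label_lt hd hL) (by omega) n).2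
  refine WP.seq (WP.move (by decide) (wp_candidates hn ends_lt
    ⟨?_, ?_, ?_, ?_, ?_, ?_, ?_, hs₁.stored.congr fun r hr _ => ?_⟩ ?_ ?_ fun s₂ hs₂ ho₂ ht₂ =>
    h s₂ hs₂ (ho₂.trans ho₁) ?_))
  all_goals try simp (disch := omega) only [Function.update_of_ne, Function.update_self]
  · exact hs₁.vertices
  · exact hs₁.edges
  · exact hs₁.modulus
  · exact hs₁.pred
  · exact hs₁.one
  · exact hs₁.labels
  · exact hs₁.list
  · rw [h7]
    exact hlt
  · exact h24₁
  · simpa only [Function.update_self, h7] using ht₂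

include hd hn hG hL in
theorem wp_decide : WP decideProg ⟨fun _ => 0, inputOf L, []⟩ (searchCost n L.length + 1)
    fun s => (IsAdditive G fE → s.out = [1]) ∧ (¬ IsAdditive G fE → s.out = [0]) := by
  refine WP.seq (wp_search hd hn hL fun s hs ho ht => WP.instr ?_)
  rw [isAdditive_iff hd hn hG hL]
  simp only [Instr.apply, ho, List.nil_append]
  rcases ht with ⟨h1, h2, h3⟩ | ⟨h1, h2⟩
  · refine ⟨fun _ => by rw [h1], fun h => absurd ?_ h⟩
    exact (isAdditive_iff hd hn hG hL).1 ⟨_, valid_labeling hd hn hG hL (by omega) h3⟩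
  · exact ⟨fun ⟨x, hx, h⟩ => absurd h (h2 x hx), fun _ => by rw [h1]⟩

include hd hn hG hL in
theorem outputOf_labelings {l : List ℕ} (hl : ∀ x ∈ l, x < 2 * d) :
    outputOf (labelings n d (directedEdges L) l) = emitted n d (directedEdges L) l := by
  induction l with
  | nil => rfl
  | cons x l ih =>
    have ih := ih fun y hy => hl y (by simp [hy])
    have hx := hl x (by simp)
    have hval : (List.ofFn fun v => (labeling n d (directedEdges L) x v).val) =
        (List.range n).map fun v => (check n d (directedEdges L) x).1 v - 1 := by
      rw [List.ofFn_congr rfl, ← List.map_coe_finRange_eq_range, List.map_map, List.ofFn_eq_map]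
      refine List.map_congr_left fun v _ => ?_
      exact val_labeling hd hL hx v (check_ne_zero hn hG hL x v)
    simp only [outputOf, labelings, emitted, List.flatMap_cons] at ih ⊢
    rw [← ih]
    by_cases h : (check n d (directedEdges L) x).2 = 0
    · simp [h, hval]
    · simp [h]

include hd hn hG hL in
theorem wp_list : WP listProg ⟨fun _ => 0, inputOf L, []⟩
    (searchCost n L.length + (enumerateCost n (L.length * 2) (numValid G fE) + 2))
    fun s => ∃ F : List (Fin n → ZMod d), F.Nodup ∧
      (∀ fV : Fin n → ZMod d, fV ∈ F ↔ IsValidVLabeling G fE fV) ∧ s.out = outputOf F := by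
  refine WP.seq (wp_search hd hn hL fun s hs ho ht => ?_)
  rw [← length_directedEdges]
  refine WP.when (fun h24 => ?_) fun h24 => ?_
  · obtain ⟨-, hy, hok⟩ := ht.resolve_right fun h => h24 h.1
    refine wp_enumerate hn ends_lt hs (fun h' => (card_of_two hd hn hG hL hy hok h').2) ?_
    intro s' ho'
    obtain ⟨h1, h2⟩ := labelings_starts hd hn hG hL hy hok
    refine ⟨_, h1, h2, ?_⟩
    rw [ho', ho, outputOf_labelings hd hn hG hL (starts_lt hy), List.nil_append]
  · rcases ht with ⟨h1, -⟩ | ⟨-, h2⟩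
    · rw [h24] at h1
      exact absurd h1 (by norm_num)
    · have hna : ¬ IsAdditive G fE := fun h => by
        obtain ⟨x, hx, hok⟩ := (isAdditive_iff hd hn hG hL).1 h
        exact h2 x hx hok
      exact ⟨[], List.nodup_nil, fun f => ⟨fun h => by simp at h, fun h => absurd ⟨f, h⟩ hna⟩, ho⟩

include hd in
-- Vertex numbers and counts are bounded by the graph size itself; only `d` and the edge labels need
-- their binary length.
theorem size_le_of_mem_inputOf : ∀ a ∈ inputOf L, Nat.size a ≤ n + L.length + Nat.size d := by
  have : NeZero d := ⟨hd.ne'⟩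
  have hself : ∀ a, Nat.size a ≤ a := fun a => Nat.size_le.2 Nat.lt_two_pow_self
  intro a ha
  simp only [inputOf, List.mem_cons, List.mem_flatMap, List.not_mem_nil, or_false] at ha
  rcases ha with rfl | rfl | rfl | ⟨x, -, rfl | rfl | rfl⟩
  · have := hself a; omega
  · have := hself L.length; omega
  · omega
  · have := hself x.1.val; omega
  · have := hself x.2.1.val; omega
  · have := Nat.size_le_size (ZMod.val_lt x.2.2).le; omega

end

/-- `Computes` needs its output named, while the list `F` appears only in the postcondition. Fixing
the final state first gives access to `F` and keeps the time bound for that same output. -/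
theorem WP.exists_state {P : Program} {s : State} {k : ℕ} {Q : State → Prop} (h : WP P s k Q) :
    ∃ s', Q s' ∧ WP P s k fun s'' => s''.out = s'.out := by
  obtain ⟨s', t, he, hq, hW⟩ := h
  exact ⟨s', hq, s', t, he, rfl, hW⟩

theorem Computes.mono {P : Program} {x y : List ℕ} {T T' : ℕ} (h : Computes P x y T)
    (hT : T ≤ T') : Computes P x y T' := by
  obtain ⟨s, t, he, hy, ht⟩ := h
  exact ⟨s, t, he, hy, ht.trans hT⟩

/-! ### Polynomial bounds for the running time -/

/-- A polynomial bound for the time of `P`, if the number of steps is at most cubic. -/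
noncomputable def timePoly (P : Program) : Polynomial ℕ :=
  2000 * (.X + 1) ^ 3 *
    (1 + 5 * (.C P.width + .X + 2000 * (.X + 1) ^ 3))

theorem Computes.of_steps {P : Program} {x y : List ℕ} {k W g : ℕ}
    (h : Computes P x y (k * (1 + 5 * (P.width + W + k)))) (hW : W ≤ g)
    (hk : k ≤ 2000 * (g + 1) ^ 3) : Computes P x y ((timePoly P).eval g) := by
  refine h.mono ?_
  simp only [timePoly, Polynomial.eval_mul, Polynomial.eval_add, Polynomial.eval_pow,
    Polynomial.eval_X, Polynomial.eval_C, Polynomial.eval_one, Polynomial.eval_ofNat]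
  gcongr

theorem checkCost_le {n m a : ℕ} (hn : n ≤ a) (hm : m ≤ a) (ha : 1 ≤ a) :
    checkCost n (m * 2) ≤ 100 * a ^ 2 := by
  have h1 : n * (m * 2 * 31 + 7) ≤ a * (a * 2 * 31 + 7) := by gcongr
  unfold checkCost
  nlinarith

theorem searchCost_le {n m a : ℕ} (hn : n ≤ a) (hm : m ≤ a) (ha : 1 ≤ a) :
    searchCost n m ≤ 600 * a ^ 2 := by
  have h1 := checkCost_le hn hm ha
  unfold searchCost
  nlinarith

/-- Up to `N ≤ a` emissions of quadratic cost make the bound cubic. -/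
theorem enumerateCost_le {n m N a : ℕ} (hn : n ≤ a) (hm : m ≤ a) (hN : N ≤ a) (ha : 1 ≤ a) :
    enumerateCost n (m * 2) N ≤ 600 * a ^ 3 := by
  have h1 := checkCost_le hn hm ha
  have ha2 : a ≤ a ^ 2 := by nlinarith
  have ha3 : a ^ 2 ≤ a ^ 3 := Nat.pow_le_pow_right ha (by norm_num)
  have h2 : emitCost n (m * 2) ≤ 112 * a ^ 2 := by
    unfold emitCost
    omega
  have h3 : N * (emitCost n (m * 2) + 4) ≤ a * (112 * a ^ 2 + 4) := by gcongr
  have h4 : a * (112 * a ^ 2 + 4) = 112 * a ^ 3 + 4 * a := by ring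
  unfold enumerateCost
  omega

end RAM

theorem theorem5p5 :
    (∃ (P : RAM.Program) (p : Polynomial ℕ),
      ∀ (n d : ℕ) (G : SimpleGraph (Fin n)) (fE : G.edgeSet → ZMod d)
        (L : List (Fin n × Fin n × ZMod d)),
        0 < d → G.Connected → ListsEdges G fE L →
          (IsAdditive G fE → RAM.Computes P (inputOf L) [1] (p.eval (graphSize G d))) ∧
          (¬ IsAdditive G fE → RAM.Computes P (inputOf L) [0] (p.eval (graphSize G d)))) ∧
    (∃ (Q : RAM.Program) (q : Polynomial ℕ),
      ∀ (n d : ℕ) (G : SimpleGraph (Fin n)) (fE : G.edgeSet → ZMod d)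
        (L : List (Fin n × Fin n × ZMod d)),
        0 < d → G.Connected → ListsEdges G fE L →
          ∃ F : List (Fin n → ZMod d),
            F.Nodup ∧ (∀ fV : Fin n → ZMod d, fV ∈ F ↔ IsValidVLabeling G fE fV) ∧
            RAM.Computes Q (inputOf L) (outputOf F)
              (q.eval (graphSize G d + numValid G fE))) := by
  refine ⟨⟨RAM.decideProg, RAM.timePoly RAM.decideProg, fun n d G fE L hd hG hL => ?_⟩,
    ⟨RAM.listProg, RAM.timePoly RAM.listProg, fun n d G fE L hd hG hL => ?_⟩⟩
  -- Connectedness includes nonemptiness, so vertex `0` exists.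
  · have hn : 0 < n := Fin.pos_iff_nonempty.2 hG.nonempty
    have hlen := hL.length_eq
    obtain ⟨s, hs, hwp⟩ := (RAM.wp_decide hd hn hG hL).exists_state
    have hcomp := (hwp.computes (RAM.size_le_of_mem_inputOf hd)).of_steps (g := graphSize G d)
      (by rw [graphSize, hlen]) (by
        have h1 := RAM.searchCost_le (n := n) (m := L.length) (a := graphSize G d + 1)
          (by rw [graphSize]; omega) (by rw [graphSize]; omega) (by omega)
        -- The quadratic bound for the search is relaxed to the cubic one that `timePoly` uses for
        -- both programs.
        have h2 := Nat.pow_le_pow_right (n := graphSize G d + 1) (by omega) (show 2 ≤ 3 by norm_num)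
        have h3 := Nat.one_le_pow 3 (graphSize G d + 1) (by omega)
        omega)
    exact ⟨fun h => hs.1 h ▸ hcomp, fun h => hs.2 h ▸ hcomp⟩
  · have hn : 0 < n := Fin.pos_iff_nonempty.2 hG.nonempty
    have hlen := hL.length_eq
    obtain ⟨s, ⟨F, hF, hF', hs⟩, hwp⟩ := (RAM.wp_list hd hn hG hL).exists_state
    refine ⟨F, hF, hF', hs ▸ ?_⟩
    generalize hg : graphSize G d + numValid G fE = g
    rw [graphSize] at hg
    refine (hwp.computes (RAM.size_le_of_mem_inputOf hd)).of_steps (g := g) (by omega) ?_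
    have h1 := RAM.searchCost_le (n := n) (m := L.length) (a := g + 1)
      (by omega) (by omega) (by omega)
    have h2 := Nat.pow_le_pow_right (n := g + 1) (by omega) (show 2 ≤ 3 by norm_num)
    have h3 := Nat.one_le_pow 3 (g + 1) (by omega)
    have h4 := RAM.enumerateCost_le (n := n) (m := L.length) (N := numValid G fE) (a := g + 1)
      (by omega) (by omega) (by omega) (by omega)
    omega
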